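/- Setting. Let $n,m\ge 1$, write $z=(x,y)\in\mathbb{R}^n\times\mathbb{R}^m$ with the Euclidean norm, let $f:\mathbb{R}^n\times\mathbb{R}^m\to\mathbb{R}$ be twice continuously differentiable on an open set $U$, and let $z^*\in U$. Write $$\nabla^2 f(z^*)=\begin{pmatrix} C & B\\ B^\top & -A\end{pmatrix},$$ and suppose that $z^*$ is a differential Stackelberg equilibrium: $\nabla_x f(z^*)=0$, $\nabla_y f(z^*)=0$, $A\succ 0$ and $C+BA^{-1}B^\top\succ 0$. Let $L\ge\max\{\|A\|_2,\|B\|_2,\|C\|_2\}$, $\mu=\lambda_{\min}(A)$, $\mu_x=\min\{L,\lambda_{\min}(C+BA^{-1}B^\top)\}$, $\kappa=L/\mu$, $\kappa_x=L/\mu_x$. Let $r\ge 2\kappa$, $\eta_x=\frac1{4rL}$, $\eta_y=\frac1{4L}$, and suppose that $$M=\begin{pmatrix} -C & -B\\ rB^\top & -rA\end{pmatrix}$$ is diagonalizable over $\mathbb{C}$, $M=P^{-1}\Lambda P$ with $\Lambda$ diagonal; put $C_P=\|P\|_2\|P^{-1}\|_2$. Algorithms. Both algorithms start from a deterministic point $z^0$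 and query a stochastic gradient oracle $g=(g_x,g_y)$. An iteration of SGDA is $x^{k+1}=x^k-\eta_x g_x(z^k)$, $y^{k+1}=y^k+\eta_y g_y(z^k)$. An iteration of stochastic EG first computes $x^{k+1/2}=x^k-\eta_x g_x(z^k)$, $y^{k+1/2}=y^k+\eta_y g_y(z^k)$, and then $x^{k+1}=x^k-\eta_x g_x(z^{k+1/2})$, $y^{k+1}=y^k+\eta_y g_y(z^{k+1/2})$. The noise of a query at a point $z$ is $\xi=(\xi_x,\xi_y)=g(z)-\nabla f(z)$ (with $\nabla f(z):=0$ at points where $f$ is not differentiable). For batch size $S$ and variance parameter $\sigma\ge 0$ it is assumed that the noises of all queries made by the algorithm are independent square-integrable random vectors with $\mathbb{E}\,\xi_x=0$, $\mathbb{E}\,\xi_y=0$, $\mathbb{E}\|\xi_x\|^2\le\sigma^2/S$ and $\mathbb{E}\|\xi_y\|^2\le\sigma^2/S$. Each query costs $S$ gradient evaluations, so that $T$ iterations cost $TS$ evaluations for SGDA and $2TS$ for EG. Theorem. There are a numerical constant $K>0$ and positive numbers $K_S(p),K_G(p)$ that depend only on $p$ such that for all data as above there is a $\delta>0$ (depending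 only on $f,U,z^*,L,r,P$) with the following property. Let $\|z^0-z^*\|\le\delta$, $0<p<1$, $\sigma\ge 0$ and $0<\varepsilon\le C_P\|z^0-z^*\|$, and put $$\ell=\max\Big\{1,\log\frac{C_P\|z^0-z^*\|}{\varepsilon}\Big\},\qquad b=\frac{r^2\kappa_x^2C_P^2\sigma^2}{L^2\varepsilon^2}\,\ell^2,\qquad T=\lceil K\,r\kappa_x\ell\,\rceil .$$ Then: 1. For every batch size $S\ge\max\{1,K_S(p)\,b\}$, the iterates of mini-batch SGDA satisfy $\|z^T-z^*\|\le\varepsilon$ with probability at least $1-p$, and so do those of mini-batch stochastic EG. 2. With the choice $S=\max\{1,\lceil K_S(p)\,b\rceil\}$, the total number of gradient evaluations of either algorithm is at most $K_G(p)\,r\kappa_x\ell\,\max\{1,b\}$. In particular, when $b\ge 1$, it is at most $K_G(p)\,\frac{r^3\kappa_x^3C_P^2\sigma^2}{L^2\varepsilon^2}\,\ell^3$. -/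

import Mathlib

open MeasureTheory ProbabilityTheory

noncomputable section

namespace Minimax

/-- The space `ℝⁿ × ℝᵐ` of points `z = (x, y)` with the Euclidean norm: the coordinates of `x` are
indexed by `Fin n` and those of `y` by `Fin m`. -/
abbrev Pt (n m : ℕ) : Type := EuclideanSpace ℝ (Fin n ⊕ Fin m)

variable {n m : ℕ}

/-- The `x`-part of `z = (x, y)`. -/
def xPart (z : Pt n m) : EuclideanSpace ℝ (Fin n) := WithLp.toLp 2 fun i => z (Sum.inl i)

/-- The `y`-part of `z = (x, y)`. -/
def yPart (z : Pt n m) : EuclideanSpace ℝ (Fin m) := WithLp.toLp 2 fun j => z (Sum.inr j)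

/-- The point `(x, y)`. -/
def mkPt (x : EuclideanSpace ℝ (Fin n)) (y : EuclideanSpace ℝ (Fin m)) : Pt n m :=
  WithLp.toLp 2 (Sum.elim (fun i => x i) (fun j => y j))

/-! ### The Hessian, its blocks, and differential Stackelberg equilibria -/

/-- The Hessian matrix of `f` at `z`; its entry at `(i, j)` is `∂ᵢ ∂ⱼ f (z)`. -/
def hessian (f : Pt n m → ℝ) (z : Pt n m) : Matrix (Fin n ⊕ Fin m) (Fin n ⊕ Fin m) ℝ :=
  Matrix.of fun i j =>
    fderiv ℝ (fderiv ℝ f) z (EuclideanSpace.single i 1) (EuclideanSpace.single j 1)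

/-- `A = -∇²_yy f (z)`. -/
def blockA (f : Pt n m → ℝ) (z : Pt n m) : Matrix (Fin m) (Fin m) ℝ := -(hessian f z).toBlocks₂₂

/-- `B = ∇²_xy f (z)`. -/
def blockB (f : Pt n m → ℝ) (z : Pt n m) : Matrix (Fin n) (Fin m) ℝ := (hessian f z).toBlocks₁₂

/-- `C = ∇²_xx f (z)`. -/
def blockC (f : Pt n m → ℝ) (z : Pt n m) : Matrix (Fin n) (Fin n) ℝ := (hessian f z).toBlocks₁₁

/-- The Schur complement `C + B A⁻¹ Bᵀ`. -/
def schur (f : Pt n m → ℝ) (z : Pt n m) : Matrix (Fin n) (Fin n) ℝ :=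
  blockC f z + blockB f z * (blockA f z)⁻¹ * (blockB f z).transpose

/-- `z` is a differential Stackelberg equilibrium of `f`: both partial gradients vanish there,
`A > 0` and `C + B A⁻¹ Bᵀ > 0`. -/
structure IsDiffStackelberg (f : Pt n m → ℝ) (z : Pt n m) : Prop where
  grad_x : xPart (gradient f z) = 0
  grad_y : yPart (gradient f z) = 0
  posDef_A : (blockA f z).PosDef
  posDef_schur : (schur f z).PosDef

/-- The spectral norm of a real or complex matrix, i.e. its operator norm with respect to the
Euclidean norms. -/
def specNorm {𝕜 ι κ : Type*} [RCLike 𝕜] [Fintype ι] [Fintype κ] [DecidableEq κ]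
    (A : Matrix ι κ 𝕜) : ℝ :=
  ‖(Matrix.toEuclideanLin A).toContinuousLinearMap‖

/-- The smallest (real) eigenvalue of a square real matrix; it is used for symmetric matrices of
positive size only, which have a nonempty finite real spectrum. -/
def lamMin {d : ℕ} (A : Matrix (Fin d) (Fin d) ℝ) : ℝ := sInf (spectrum ℝ A)

/-- `κ = L / μ` with `μ = λ_min(A)`. -/
def kappa (f : Pt n m → ℝ) (z : Pt n m) (L : ℝ) : ℝ := L / lamMin (blockA f z)

/-- `κ_x = L / μ_x` with `μ_x = min {L, λ_min(C + B A⁻¹ Bᵀ)}`. -/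
def kappaX (f : Pt n m → ℝ) (z : Pt n m) (L : ℝ) : ℝ := L / min L (lamMin (schur f z))

/-- The matrix `M = [-C, -B; r Bᵀ, -r A]`. -/
def matM (f : Pt n m → ℝ) (z : Pt n m) (r : ℝ) :
    Matrix (Fin n ⊕ Fin m) (Fin n ⊕ Fin m) ℝ :=
  Matrix.fromBlocks (-blockC f z) (-blockB f z)
    (r • (blockB f z).transpose) (-(r • blockA f z))

/-- `M = P⁻¹ Λ P` is an eigenvalue decomposition of the real matrix `M` over `ℂ`. -/
def IsEigDecomp {ι : Type*} [Fintype ι] [DecidableEq ι] (M : Matrix ι ι ℝ) (P : Matrix ι ι ℂ)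
    (ev : ι → ℂ) : Prop :=
  IsUnit P.det ∧ M.map (fun a : ℝ => (a : ℂ)) = P⁻¹ * Matrix.diagonal ev * P

/-- The condition number `C_P = ‖P‖₂ ‖P⁻¹‖₂`. -/
def condNum {ι : Type*} [Fintype ι] [DecidableEq ι] (P : Matrix ι ι ℂ) : ℝ :=
  specNorm P * specNorm P⁻¹

/-! ### Stochastic dynamics

A stochastic oracle is a sequence of random vector fields `g j ω : ℝⁿ × ℝᵐ → ℝⁿ × ℝᵐ`; the `j`-th
query, made at the point `z`, returns `g j ω z = (g_x, g_y)`. -/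

variable {Ω : Type*}

/-- `(x - η_x g_x, y + η_y g_y)`. -/
def step (ηx ηy : ℝ) (z g : Pt n m) : Pt n m :=
  mkPt (xPart z - ηx • xPart g) (yPart z + ηy • yPart g)

/-- The iterates of stochastic gradient descent ascent: iteration `k` uses query `k`. -/
def sgda (g : ℕ → Ω → Pt n m → Pt n m) (ηx ηy : ℝ) (z₀ : Pt n m) : ℕ → Ω → Pt n m
  | 0, _ => z₀
  | k + 1, ω => step ηx ηy (sgda g ηx ηy z₀ k ω) (g k ω (sgda g ηx ηy z₀ k ω))

/-- The iterates of stochastic extra-gradient: iteration `k` uses query `2k` at `z^k` to obtain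
`z^{k+1/2}`, and then query `2k+1` at `z^{k+1/2}` to obtain `z^{k+1}` from `z^k`. -/
def seg (g : ℕ → Ω → Pt n m → Pt n m) (ηx ηy : ℝ) (z₀ : Pt n m) : ℕ → Ω → Pt n m
  | 0, _ => z₀
  | k + 1, ω =>
    step ηx ηy (seg g ηx ηy z₀ k ω)
      (g (2 * k + 1) ω
        (step ηx ηy (seg g ηx ηy z₀ k ω) (g (2 * k) ω (seg g ηx ηy z₀ k ω))))

/-- The point of the `j`-th query of stochastic extra-gradient: `z^k` if `j = 2k`, and `z^{k+1/2}`
if `j = 2k+1`. -/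
def segQuery (g : ℕ → Ω → Pt n m → Pt n m) (ηx ηy : ℝ) (z₀ : Pt n m) (j : ℕ) (ω : Ω) : Pt n m :=
  if j % 2 = 0 then seg g ηx ηy z₀ (j / 2) ω
  else step ηx ηy (seg g ηx ηy z₀ (j / 2) ω)
    (g (2 * (j / 2)) ω (seg g ηx ηy z₀ (j / 2) ω))

/-- The noise of the `j`-th query, made at the random point `q j`: what the oracle returns minus the
true gradient. -/
def noise (f : Pt n m → ℝ) (g : ℕ → Ω → Pt n m → Pt n m) (q : ℕ → Ω → Pt n m)
    (j : ℕ) (ω : Ω) : Pt n m :=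
  g j ω (q j ω) - gradient f (q j ω)

/-- The noises `ξ j = (ξ_x j, ξ_y j)` of a mini-batch gradient with batch size `S` are
square-integrable random vectors, have mean zero, satisfy `E ‖ξ_x‖² ≤ σ² / S` and
`E ‖ξ_y‖² ≤ σ² / S`, and are independent for different queries. -/
structure IsMiniBatchNoise [MeasurableSpace Ω] (P : Measure Ω) (σ : ℝ) (S : ℕ)
    (ξ : ℕ → Ω → Pt n m) : Prop where
  memLp : ∀ j, MemLp (ξ j) 2 P
  mean_x : ∀ j, ∫ ω, xPart (ξ j ω) ∂P = 0
  mean_y : ∀ j, ∫ ω, yPart (ξ j ω) ∂P = 0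
  var_x : ∀ j, ∫ ω, ‖xPart (ξ j ω)‖ ^ 2 ∂P ≤ σ ^ 2 / S
  var_y : ∀ j, ∫ ω, ‖yPart (ξ j ω)‖ ^ 2 ∂P ≤ σ ^ 2 / S
  indep : iIndepFun ξ P

/-- Gradient evaluations of `T` iterations of mini-batch SGDA (one query per iteration, `S`
evaluations per query). -/
def sgdaCost (T S : ℕ) : ℕ := T * S

/-- Gradient evaluations of `T` iterations of mini-batch stochastic EG (two queries per
iteration, `S` evaluations per query). -/
def segCost (T S : ℕ) : ℕ := 2 * T * S

/-- The logarithmic factor `max {1, log (C_P ‖z⁰ - z*‖ / ε)}`, with `d = ‖z⁰ - z*‖`. -/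
def logFactor (CP d ε : ℝ) : ℝ := max 1 (Real.log (CP * d / ε))

/-- The expression `r² κ_x² C_P² σ² / (L² ε²) · ℓ²` that governs the batch size. -/
def batchFactor (r κx CP σ L ε ℓ : ℝ) : ℝ :=
  r ^ 2 * κx ^ 2 * CP ^ 2 * σ ^ 2 / (L ^ 2 * ε ^ 2) * ℓ ^ 2

end Minimax

end

open Minimax

/-! Near `zs` one iteration is a small perturbation of a linear map. Since ηy = r ηx, scaling the
Hessian by the step sizes gives η M with η = ηx, so in the linear model SGDA multiplies the error by
1 + ηM and EG by 1 + ηM + (ηM)².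

The core is the location of the spectrum of M (`eigenvalue_bounds`). Real eigenvalues lie in [-rL,
-μx]; nonreal ones satisfy Re λ ≤ -L/2 and |λ|² ≤ 3rL². The timescale condition r ≥ 2κ keeps the
ascent block dominant, and the Schur complement controls the slow real modes. With τ = 1/(r κ_x),
both factors are then at most 1 - τ/32 in modulus on every eigenvector (`contraction_factors`).

Errors are measured by `eigNorm`, the norm of the coordinates in the eigenbasis. There M acts
diagonally, so the contraction is exact at each step, and C_P is paid only once, when passing to the
Euclidean norm and back. On a small ball the nonlinear remainder costs at most half of the rate
(`exists_locallyContracting`).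

Noise is handled pathwise. If the norms of all noises sum to a small enough number, a bootstrap
keeps the iterates in the ball, and the final error is a geometric term plus that sum
(`gradient_iterates_le`, `extragradient_iterates_le`). Cauchy–Schwarz and Markov bound the
probability that the sum is large by a multiple of T²σ²/S, whence the squares of r κ_x ℓ in b. -/

namespace Minimax

/-! ### Location of the spectrum, in operator form -/

section Spectral

open scoped RealInnerProductSpace

variable {X Y : Type*} [NormedAddCommGroup X] [InnerProductSpace ℝ X]
  [NormedAddCommGroup Y] [InnerProductSpace ℝ Y]

/-- The blocks of a Hessian `[C, B; Bᵀ, -A]` with `‖B‖, ‖C‖ ≤ L`, `A ≥ μ` and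
`C + B A⁻¹ Bᵀ ≥ μx`, as operators between real inner product spaces. -/
structure StackelbergBlocks (A : Y →ₗ[ℝ] Y) (B : Y →ₗ[ℝ] X) (Bt : X →ₗ[ℝ] Y) (C : X →ₗ[ℝ] X)
    (L μ μx r : ℝ) : Prop where
  symm_C : ∀ x x', ⟪C x, x'⟫ = ⟪x, C x'⟫
  symm_A : ∀ y y', ⟪A y, y'⟫ = ⟪y, A y'⟫
  adj : ∀ x y, ⟪Bt x, y⟫ = ⟪x, B y⟫
  norm_A : ∀ y, ‖A y‖ ≤ L * ‖y‖
  norm_B : ∀ y, ‖B y‖ ≤ L * ‖y‖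
  norm_C : ∀ x, ‖C x‖ ≤ L * ‖x‖
  surj_A : ∀ y, ∃ y', A y' = y
  coercive_A : ∀ y, μ * ‖y‖ ^ 2 ≤ ⟪A y, y⟫
  coercive_schur : ∀ u w, A w = Bt u → μx * ‖u‖ ^ 2 ≤ ⟪C u, u⟫ + ⟪B w, u⟫
  L_pos : 0 < L
  mu_pos : 0 < μ
  mux_pos : 0 < μx
  mux_le : μx ≤ L
  two_le : 2 ≤ r
  two_mul_le : 2 * L ≤ r * μ

namespace StackelbergBlocks

variable {A : Y →ₗ[ℝ] Y} {B : Y →ₗ[ℝ] X} {Bt : X →ₗ[ℝ] Y} {C : X →ₗ[ℝ] X} {L μ μx r : ℝ}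

lemma abs_inner_C_le (h : StackelbergBlocks A B Bt C L μ μx r) (u : X) :
    |⟪C u, u⟫| ≤ L * ‖u‖ ^ 2 := by
  have := (abs_real_inner_le_norm (C u) u).trans
    (mul_le_mul_of_nonneg_right (h.norm_C u) (norm_nonneg u))
  linarith

lemma inner_A_le (h : StackelbergBlocks A B Bt C L μ μx r) (y : Y) :
    ⟪A y, y⟫ ≤ L * ‖y‖ ^ 2 := by
  have := (real_inner_le_norm (A y) y).trans
    (mul_le_mul_of_nonneg_right (h.norm_A y) (norm_nonneg y))
  linarith

/-- Weighting the two tested equations by r and 1 cancels the coupling by B, which gives the lower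
bound. For the upper bound, if a > -μx, put t = a/r: then Bᵀu = (A + t)v, and Schur coercivity
yields (a + μx)‖u‖² ≤ t(1 + t/μ)‖v‖². This is impossible for t ≤ 0 because μ + t > 0, and for t > 0
because the first equation bounds (μ + t)‖v‖² by L‖u‖². -/
lemma real_eigenvalue_bounds (h : StackelbergBlocks A B Bt C L μ μx r) {u : X} {v : Y} {a : ℝ}
    (hne : u ≠ 0 ∨ v ≠ 0) (hu : a • u = -(C u) - B v) (hv : a • v = r • Bt u - r • A v) :
    -(r * L) ≤ a ∧ a ≤ -μx := by
  have hL := h.L_pos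
  have hμ := h.mu_pos
  have hμx := h.mux_pos
  have hr2 := h.two_le
  have hr : 0 < r := by linarith
  have hrμ := h.two_mul_le
  have hxL := h.mux_le
  have e1 : a * ‖u‖ ^ 2 = -⟪C u, u⟫ - ⟪B v, u⟫ := by
    have := congrArg (fun t => ⟪t, u⟫) hu
    simpa [inner_smul_left, inner_sub_left, inner_neg_left] using this
  have e2 : a * ‖v‖ ^ 2 = r * ⟪B v, u⟫ - r * ⟪A v, v⟫ := by
    have := congrArg (fun t => ⟪t, v⟫) hv
    simp only [inner_smul_left, inner_sub_left, h.adj, real_inner_self_eq_norm_sq] at this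
    rw [real_inner_comm] at this
    simpa using this
  have hc := abs_le.1 (h.abs_inner_C_le u)
  have hα := h.coercive_A v
  have hα' := h.inner_A_le v
  have hpos : 0 < r * ‖u‖ ^ 2 + ‖v‖ ^ 2 := by
    rcases hne with h0 | h0
    · have := norm_pos_iff.2 h0; positivity
    · have := norm_pos_iff.2 h0; positivity
  have hV : 0 ≤ ‖v‖ ^ 2 := by positivity
  have hU : 0 ≤ ‖u‖ ^ 2 := by positivity
  have key : a * (r * ‖u‖ ^ 2 + ‖v‖ ^ 2) = -(r * (⟪C u, u⟫ + ⟪A v, v⟫)) := by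
    linear_combination r * e1 + e2
  refine ⟨?_, ?_⟩
  · by_contra! hlt
    have h1 := mul_lt_mul_of_pos_right hlt hpos
    have h2 : r * (⟪C u, u⟫ + ⟪A v, v⟫) ≤ r * (L * ‖u‖ ^ 2 + L * ‖v‖ ^ 2) :=
      mul_le_mul_of_nonneg_left (by linarith) hr.le
    have h3 : 0 ≤ (r * L) * ((r - 1) * ‖u‖ ^ 2) :=
      mul_nonneg (by positivity) (mul_nonneg (by linarith) hU)
    nlinarith
  by_contra! hlt
  obtain ⟨v', hv'⟩ := h.surj_A v
  set t : ℝ := a / r with ht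
  have hta : a = r * t := by rw [ht]; field_simp
  have hBt : Bt u = A v + t • v := by
    have h1 : r • Bt u = r • (A v + t • v) := by
      rw [smul_add, smul_smul, ← hta, hv]; abel
    exact smul_right_injective Y hr.ne' h1
  -- The vector v + t v' is A⁻¹Bᵀu, obtained without an inverse: v' is a preimage of v under A.
  have hs := h.coercive_schur u (v + t • v') (by rw [map_add, map_smul, hv', hBt])
  have hs1 : ⟪B v, u⟫ = ⟪A v, v⟫ + t * ‖v‖ ^ 2 := by
    rw [real_inner_comm, ← h.adj, hBt, inner_add_left, inner_smul_left]
    simp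
  have hs2 : ⟪B v', u⟫ = ‖v‖ ^ 2 + t * ⟪v, v'⟫ := by
    rw [real_inner_comm, ← h.adj, hBt, inner_add_left, inner_smul_left, h.symm_A, hv']
    simp
  rw [map_add, map_smul, inner_add_left, inner_smul_left, hs1, hs2] at hs
  simp only [conj_trivial] at hs
  have hβ : μ * ⟪v, v'⟫ ≤ ‖v‖ ^ 2 := by
    have h1 : μ * ‖v'‖ ^ 2 ≤ ⟪v, v'⟫ := by simpa [hv'] using h.coercive_A v'
    have h2 := real_inner_le_norm v v'
    have h3 : μ * ‖v'‖ ≤ ‖v‖ := by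
      rcases (norm_nonneg v').eq_or_lt with h0 | h0
      · rw [← h0]; simp
      · nlinarith
    nlinarith [norm_nonneg v]
  have hmain : (a + μx) * ‖u‖ ^ 2 ≤ t * ‖v‖ ^ 2 + t ^ 2 * ⟪v, v'⟫ := by
    rw [hs1] at e1
    nlinarith
  have hmain' : μ * ((a + μx) * ‖u‖ ^ 2) ≤ t * (μ + t) * ‖v‖ ^ 2 := by
    have := mul_le_mul_of_nonneg_left hβ (sq_nonneg t)
    nlinarith
  -- Here a > -μx ≥ -L, while rμ ≥ 2L.
  have hμt : 0 < μ + t := by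
    have : 0 < r * (μ + t) := by rw [mul_add, ← hta]; linarith
    exact (mul_pos_iff_of_pos_left hr).1 this
  have hUpos : 0 < ‖u‖ ^ 2 := by
    refine pow_pos (norm_pos_iff.2 fun h0 => ?_) 2
    have hv0 : 0 < ‖v‖ ^ 2 := by simpa [h0] using hpos
    have : ⟪A v, v⟫ + t * ‖v‖ ^ 2 = 0 := by rw [← hs1, h0]; simp
    nlinarith
  have hax : 0 < (a + μx) * ‖u‖ ^ 2 := mul_pos (by linarith) hUpos
  rcases le_or_gt t 0 with ht0 | ht0
  · have : t * (μ + t) * ‖v‖ ^ 2 ≤ 0 :=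
      mul_nonpos_of_nonpos_of_nonneg (mul_nonpos_of_nonpos_of_nonneg ht0 hμt.le) hV
    nlinarith [mul_pos hμ hax]
  · have ha0 : 0 < a := by rw [hta]; positivity
    have h1 : (μ + t) * ‖v‖ ^ 2 ≤ L * ‖u‖ ^ 2 := by
      rw [hs1] at e1
      have := mul_pos ha0 hUpos
      linarith
    have h2 : t * ((μ + t) * ‖v‖ ^ 2) ≤ t * (L * ‖u‖ ^ 2) := mul_le_mul_of_nonneg_left h1 ht0.le
    have h3 : 2 * L * (t * ‖u‖ ^ 2) ≤ r * μ * (t * ‖u‖ ^ 2) :=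
      mul_le_mul_of_nonneg_right hrμ (by positivity)
    have h4 : μ * (a * ‖u‖ ^ 2) = r * μ * (t * ‖u‖ ^ 2) := by rw [hta]; ring
    have h5 : 0 < μ * (a * ‖u‖ ^ 2) := by positivity
    have h6 : 0 < μ * (μx * ‖u‖ ^ 2) := by positivity
    linarith

/-- The imaginary parts of the tested equations force ‖v‖² = r‖u‖² for the complex eigenvector. With
this balance the term μ‖v‖² ≥ 2L‖u‖² from A outweighs the possible negativity -L‖u‖² of C, and the
first block row alone bounds |λ|. -/
lemma nonreal_eigenvalue_bounds (h : StackelbergBlocks A B Bt C L μ μx r) {u₁ u₂ : X} {v₁ v₂ : Y}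
    {a b : ℝ} (hb : b ≠ 0) (hne : u₁ ≠ 0 ∨ v₁ ≠ 0 ∨ u₂ ≠ 0 ∨ v₂ ≠ 0)
    (hu₁ : a • u₁ - b • u₂ = -(C u₁) - B v₁) (hu₂ : a • u₂ + b • u₁ = -(C u₂) - B v₂)
    (hv₁ : a • v₁ - b • v₂ = r • Bt u₁ - r • A v₁)
    (hv₂ : a • v₂ + b • v₁ = r • Bt u₂ - r • A v₂) :
    a ≤ -L / 2 ∧ a ^ 2 + b ^ 2 ≤ 3 * r * L ^ 2 := by
  have hL := h.L_pos
  have hμ := h.mu_pos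
  have hr2 := h.two_le
  have hr : 0 < r := by linarith
  have hrμ := h.two_mul_le
  have ipX {p q : X} (hpq : p = q) (w : X) : ⟪p, w⟫ = ⟪q, w⟫ := by rw [hpq]
  have ipY {p q : Y} (hpq : p = q) (w : Y) : ⟪p, w⟫ = ⟪q, w⟫ := by rw [hpq]
  have p11 := ipX hu₁ u₁
  have p12 := ipX hu₁ u₂
  have p21 := ipX hu₂ u₁
  have p22 := ipX hu₂ u₂
  have q11 := ipY hv₁ v₁
  have q12 := ipY hv₁ v₂
  have q21 := ipY hv₂ v₁
  have q22 := ipY hv₂ v₂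
  simp only [inner_sub_left, inner_add_left, inner_neg_left, real_inner_smul_left, h.adj,
    real_inner_self_eq_norm_sq] at p11 p12 p21 p22 q11 q12 q21 q22
  have cu : ⟪u₂, u₁⟫ = ⟪u₁, u₂⟫ := real_inner_comm _ _
  have cv : ⟪v₂, v₁⟫ = ⟪v₁, v₂⟫ := real_inner_comm _ _
  have cC : ⟪C u₂, u₁⟫ = ⟪C u₁, u₂⟫ := by rw [h.symm_C, real_inner_comm]
  have cA : ⟪A v₂, v₁⟫ = ⟪A v₁, v₂⟫ := by rw [h.symm_A, real_inner_comm]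
  rw [real_inner_comm u₁ (B v₁)] at p11
  rw [real_inner_comm u₂ (B v₁)] at p12
  rw [real_inner_comm u₁ (B v₂), cu, cC] at p21
  rw [real_inner_comm u₂ (B v₂)] at p22
  rw [cv] at q11
  rw [cv, cA] at q21
  rw [cu] at p11
  set U := ‖u₁‖ ^ 2 + ‖u₂‖ ^ 2 with hU
  set V := ‖v₁‖ ^ 2 + ‖v₂‖ ^ 2 with hV
  have hVU : V = r * U := by
    have : b * V = b * (r * U) := by
      rw [hU, hV]
      linear_combination q21 - q12 - r * (p21 - p12)
    exact mul_left_cancel₀ hb this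
  have hUpos : 0 < U := by
    by_contra! h0
    have hU0 : U = 0 := le_antisymm h0 (by positivity)
    rw [hU0, mul_zero] at hVU
    have n1 : ‖u₁‖ ^ 2 = 0 := by linarith [sq_nonneg ‖u₁‖, sq_nonneg ‖u₂‖]
    have n2 : ‖u₂‖ ^ 2 = 0 := by linarith [sq_nonneg ‖u₁‖, sq_nonneg ‖u₂‖]
    have n3 : ‖v₁‖ ^ 2 = 0 := by linarith [sq_nonneg ‖v₁‖, sq_nonneg ‖v₂‖]
    have n4 : ‖v₂‖ ^ 2 = 0 := by linarith [sq_nonneg ‖v₁‖, sq_nonneg ‖v₂‖]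
    simp at n1 n2 n3 n4
    simp [n1, n2, n3, n4] at hne
  constructor
  · have key : 2 * a * (r * U) = -(r * (⟪C u₁, u₁⟫ + ⟪C u₂, u₂⟫ + ⟪A v₁, v₁⟫ + ⟪A v₂, v₂⟫)) := by
      have e : a * (r * U) + a * V
          = -(r * (⟪C u₁, u₁⟫ + ⟪C u₂, u₂⟫ + ⟪A v₁, v₁⟫ + ⟪A v₂, v₂⟫)) := by
        rw [hU, hV]
        linear_combination r * (p11 + p22) + q11 + q22
      rw [hVU] at e
      linarith
    have c1 := (abs_le.1 (h.abs_inner_C_le u₁)).1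
    have c2 := (abs_le.1 (h.abs_inner_C_le u₂)).1
    have a1 := h.coercive_A v₁
    have a2 := h.coercive_A v₂
    have h1 : -(L * U) + μ * V ≤ ⟪C u₁, u₁⟫ + ⟪C u₂, u₂⟫ + ⟪A v₁, v₁⟫ + ⟪A v₂, v₂⟫ := by
      rw [hU, hV]; linarith
    have h2 : 2 * L * U ≤ μ * V := by
      have := mul_le_mul_of_nonneg_right hrμ hUpos.le
      rw [hVU]; linarith
    have h3 : 2 * a * U = -(⟪C u₁, u₁⟫ + ⟪C u₂, u₂⟫ + ⟪A v₁, v₁⟫ + ⟪A v₂, v₂⟫) :=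
      mul_left_cancel₀ hr.ne' (by linear_combination key)
    by_contra! hlt
    have := mul_lt_mul_of_pos_right hlt hUpos
    linarith
  · have bound (u : X) (v : Y) : ‖-(C u) - B v‖ ^ 2 ≤ 2 * L ^ 2 * (‖u‖ ^ 2 + ‖v‖ ^ 2) := by
      have h1 : ‖-(C u) - B v‖ ≤ L * ‖u‖ + L * ‖v‖ :=
        (norm_sub_le _ _).trans (by rw [norm_neg]; exact add_le_add (h.norm_C u) (h.norm_B v))
      have h2 := pow_le_pow_left₀ (norm_nonneg _) h1 2
      nlinarith [sq_nonneg (L * (‖u‖ - ‖v‖))]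
    have b1 := bound u₁ v₁
    have b2 := bound u₂ v₂
    rw [← hu₁, norm_sub_sq_real, norm_smul, norm_smul, mul_pow, mul_pow, Real.norm_eq_abs,
      Real.norm_eq_abs, sq_abs, sq_abs, real_inner_smul_left, real_inner_smul_right] at b1
    rw [← hu₂, norm_add_sq_real, norm_smul, norm_smul, mul_pow, mul_pow, Real.norm_eq_abs,
      Real.norm_eq_abs, sq_abs, sq_abs, real_inner_smul_left, real_inner_smul_right, cu] at b2
    have h1 : (a ^ 2 + b ^ 2) * U ≤ 2 * L ^ 2 * (U + V) := by
      rw [hU, hV]; linarith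
    have h2 : 2 * L ^ 2 * (U + V) ≤ 3 * r * L ^ 2 * U := by
      rw [hVU]
      have : 0 ≤ (r - 2) * (L ^ 2 * U) := mul_nonneg (by linarith) (by positivity)
      linarith
    exact le_of_mul_le_mul_right (h1.trans h2) hUpos

end StackelbergBlocks

end Spectral

/-! ### From matrices to operators, and the eigenvalues of M -/

section Matrices

open scoped RealInnerProductSpace
open Matrix

lemma specNorm_nonneg {𝕜 ι κ : Type*} [RCLike 𝕜] [Fintype ι] [Fintype κ] [DecidableEq κ]
    (A : Matrix ι κ 𝕜) : 0 ≤ specNorm A := norm_nonneg _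

lemma norm_toEuclideanLin_le {𝕜 ι κ : Type*} [RCLike 𝕜] [Fintype ι] [Fintype κ] [DecidableEq κ]
    (A : Matrix ι κ 𝕜) (x : EuclideanSpace 𝕜 κ) :
    ‖toEuclideanLin A x‖ ≤ specNorm A * ‖x‖ :=
  (toEuclideanLin A).toContinuousLinearMap.le_opNorm x

lemma inner_toEuclideanLin_transpose {ι κ : Type*} [Fintype ι] [Fintype κ] [DecidableEq ι]
    [DecidableEq κ] (A : Matrix ι κ ℝ) (x : EuclideanSpace ℝ ι) (y : EuclideanSpace ℝ κ) :
    ⟪toEuclideanLin Aᵀ x, y⟫ = ⟪x, toEuclideanLin A y⟫ := by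
  rw [← conjTranspose_eq_transpose_of_trivial, toEuclideanLin_conjTranspose_eq_adjoint,
    LinearMap.adjoint_inner_left]

lemma toEuclideanLin_mul_apply {𝕜 ι κ τ : Type*} [RCLike 𝕜] [Fintype ι] [Fintype κ] [Fintype τ]
    [DecidableEq κ] [DecidableEq τ] (A : Matrix ι κ 𝕜) (B : Matrix κ τ 𝕜)
    (x : EuclideanSpace 𝕜 τ) :
    toEuclideanLin (A * B) x = toEuclideanLin A (toEuclideanLin B x) := by
  simp [toLpLin_apply, mulVec_mulVec]

lemma inner_toEuclideanLin_comm {ι : Type*} [Fintype ι] [DecidableEq ι]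
    {A : Matrix ι ι ℝ} (hA : A.IsHermitian) (x y : EuclideanSpace ℝ ι) :
    ⟪toEuclideanLin A x, y⟫ = ⟪x, toEuclideanLin A y⟫ := by
  rw [← inner_toEuclideanLin_transpose, ← conjTranspose_eq_transpose_of_trivial, hA.eq]

lemma lamMin_mul_norm_sq_le {d : ℕ} {A : Matrix (Fin d) (Fin d) ℝ} (hA : A.IsHermitian)
    (y : EuclideanSpace ℝ (Fin d)) : lamMin A * ‖y‖ ^ 2 ≤ ⟪toEuclideanLin A y, y⟫ := by
  have hpsd : (A - algebraMap ℝ (Matrix (Fin d) (Fin d) ℝ) (lamMin A)).PosSemidef := by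
    rw [posSemidef_iff_isHermitian_and_spectrum_nonneg]
    refine ⟨hA.sub (by simp [IsHermitian, algebraMap_eq_diagonal]), ?_⟩
    intro a ha
    rw [← spectrum.sub_singleton_eq] at ha
    obtain ⟨c, hc, _, rfl, rfl⟩ := ha
    have : lamMin A ≤ c := csInf_le A.finite_real_spectrum.bddBelow hc
    simpa using this
  have h := (isPositive_toEuclideanLin_iff.2 hpsd).inner_nonneg_left y
  rw [map_sub, LinearMap.sub_apply, inner_sub_left] at h
  have e : toEuclideanLin (algebraMap ℝ (Matrix (Fin d) (Fin d) ℝ) (lamMin A)) y = lamMin A • y := by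
    simp [Algebra.algebraMap_eq_smul_one]
  rw [e, real_inner_smul_left, real_inner_self_eq_norm_sq] at h
  linarith

lemma lamMin_pos {d : ℕ} (hd : 0 < d) {A : Matrix (Fin d) (Fin d) ℝ} (hA : A.PosDef) :
    0 < lamMin A := by
  have hne : (spectrum ℝ A).Nonempty := by
    rw [hA.1.spectrum_real_eq_range_eigenvalues]
    exact ⟨_, ⟨⟨0, hd⟩, rfl⟩⟩
  have hmem : lamMin A ∈ spectrum ℝ A := hne.csInf_mem A.finite_real_spectrum
  rw [hA.1.spectrum_real_eq_range_eigenvalues] at hmem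
  obtain ⟨i, hi⟩ := hmem
  rw [← hi]
  exact hA.eigenvalues_pos i

lemma lamMin_le_specNorm {d : ℕ} (hd : 0 < d) {A : Matrix (Fin d) (Fin d) ℝ}
    (hA : A.IsHermitian) : lamMin A ≤ specNorm A := by
  have h1 := lamMin_mul_norm_sq_le hA (EuclideanSpace.single ⟨0, hd⟩ 1)
  have h2 := real_inner_le_norm (toEuclideanLin A (EuclideanSpace.single ⟨0, hd⟩ 1))
    (EuclideanSpace.single ⟨0, hd⟩ 1)
  have h3 := norm_toEuclideanLin_le A (EuclideanSpace.single ⟨0, hd⟩ 1)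
  simp only [PiLp.norm_single, norm_one, one_pow, mul_one] at h1 h2 h3
  linarith

variable {n m : ℕ} {f : Pt n m → ℝ} {zs : Pt n m} {L r : ℝ}

/-- Positive definiteness includes symmetry, so C is a difference of symmetric matrices; smoothness
of f is not needed here. -/
lemma IsDiffStackelberg.isHermitian_blockC (hz : IsDiffStackelberg f zs) :
    (blockC f zs).IsHermitian := by
  have h : blockC f zs = schur f zs
      - blockB f zs * (blockA f zs)⁻¹ * (blockB f zs)ᴴ := by
    rw [schur, conjTranspose_eq_transpose_of_trivial]; simp
  rw [h]
  exact hz.posDef_schur.1.sub (isHermitian_mul_mul_conjTranspose _ hz.posDef_A.1.inv)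

lemma IsDiffStackelberg.stackelbergBlocks (hz : IsDiffStackelberg f zs) (hn : 0 < n) (hm : 0 < m)
    (hA : specNorm (blockA f zs) ≤ L) (hB : specNorm (blockB f zs) ≤ L)
    (hC : specNorm (blockC f zs) ≤ L) (hr : 2 * kappa f zs L ≤ r) :
    StackelbergBlocks (toEuclideanLin (blockA f zs)) (toEuclideanLin (blockB f zs))
      (toEuclideanLin (blockB f zs)ᵀ) (toEuclideanLin (blockC f zs)) L (lamMin (blockA f zs))
      (min L (lamMin (schur f zs))) r := by
  have hμ := lamMin_pos hm hz.posDef_A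
  have hμL : lamMin (blockA f zs) ≤ L := (lamMin_le_specNorm hm hz.posDef_A.1).trans hA
  have hL : 0 < L := hμ.trans_le hμL
  have hdet : IsUnit (blockA f zs).det := hz.posDef_A.det_pos.ne'.isUnit
  have hinv (y) : toEuclideanLin (blockA f zs) (toEuclideanLin (blockA f zs)⁻¹ y) = y := by
    rw [← toEuclideanLin_mul_apply, mul_nonsing_inv _ hdet]
    simp
  have hinv' (y) : toEuclideanLin (blockA f zs)⁻¹ (toEuclideanLin (blockA f zs) y) = y := by
    rw [← toEuclideanLin_mul_apply, nonsing_inv_mul _ hdet]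
    simp
  have hκ : 2 * L ≤ r * lamMin (blockA f zs) := by
    rw [kappa, ← mul_div_assoc, div_le_iff₀ hμ] at hr
    exact hr
  refine
    { symm_C := inner_toEuclideanLin_comm hz.isHermitian_blockC
      symm_A := inner_toEuclideanLin_comm hz.posDef_A.1
      adj := inner_toEuclideanLin_transpose _
      norm_A := fun y => (norm_toEuclideanLin_le _ y).trans (by gcongr)
      norm_B := fun y => (norm_toEuclideanLin_le _ y).trans (by gcongr)
      norm_C := fun y => (norm_toEuclideanLin_le _ y).trans (by gcongr)
      surj_A := fun y => ⟨_, hinv y⟩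
      coercive_A := lamMin_mul_norm_sq_le hz.posDef_A.1
      coercive_schur := fun u w hw => ?_
      L_pos := hL
      mu_pos := hμ
      mux_pos := lt_min hL (lamMin_pos hn hz.posDef_schur)
      mux_le := min_le_left _ _
      two_le := ?_
      two_mul_le := hκ }
  · have h := lamMin_mul_norm_sq_le hz.posDef_schur.1 u
    have e : toEuclideanLin (schur f zs) u
        = toEuclideanLin (blockC f zs) u + toEuclideanLin (blockB f zs) w := by
      rw [schur, map_add, LinearMap.add_apply, toEuclideanLin_mul_apply, toEuclideanLin_mul_apply,
        ← hw, hinv']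
    rw [e, inner_add_left] at h
    exact (mul_le_mul_of_nonneg_right (min_le_right _ _) (sq_nonneg _)).trans h
  · have : 1 ≤ kappa f zs L := by rw [kappa, le_div_iff₀ hμ]; linarith
    linarith

/-! ### Blocks of points and of `M` -/

@[simp] lemma xPart_apply (z : Pt n m) (i : Fin n) : xPart z i = z (Sum.inl i) := rfl

@[simp] lemma yPart_apply (z : Pt n m) (j : Fin m) : yPart z j = z (Sum.inr j) := rfl

@[simp] lemma mkPt_inl (x : EuclideanSpace ℝ (Fin n)) (y : EuclideanSpace ℝ (Fin m)) (i : Fin n) :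
    mkPt x y (Sum.inl i) = x i := rfl

@[simp] lemma mkPt_inr (x : EuclideanSpace ℝ (Fin n)) (y : EuclideanSpace ℝ (Fin m)) (j : Fin m) :
    mkPt x y (Sum.inr j) = y j := rfl

lemma norm_sq_eq_parts (z : Pt n m) : ‖z‖ ^ 2 = ‖xPart z‖ ^ 2 + ‖yPart z‖ ^ 2 := by
  simp [EuclideanSpace.norm_sq_eq]

lemma xPart_matM (e : Pt n m) : xPart (toEuclideanLin (matM f zs r) e)
    = -(toEuclideanLin (blockC f zs) (xPart e)) - toEuclideanLin (blockB f zs) (yPart e) := by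
  ext i
  simp [matM, toLpLin_apply, mulVec, dotProduct, sub_eq_add_neg]

lemma yPart_matM (e : Pt n m) : yPart (toEuclideanLin (matM f zs r) e)
    = r • toEuclideanLin (blockB f zs)ᵀ (xPart e) - r • toEuclideanLin (blockA f zs) (yPart e) := by
  ext i
  simp [matM, toLpLin_apply, mulVec, dotProduct, sub_eq_add_neg, Finset.mul_sum, mul_assoc]

lemma eq_zero_of_parts {z : Pt n m} (hx : xPart z = 0) (hy : yPart z = 0) : z = 0 := by
  have := norm_sq_eq_parts z
  rw [hx, hy] at this
  simpa using this

/-- The location of the eigenvalues of `M`. -/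
lemma eigenvalue_bounds (hS : StackelbergBlocks (toEuclideanLin (blockA f zs))
      (toEuclideanLin (blockB f zs)) (toEuclideanLin (blockB f zs)ᵀ) (toEuclideanLin (blockC f zs))
      L (lamMin (blockA f zs)) (min L (lamMin (schur f zs))) r)
    {Q : Matrix (Fin n ⊕ Fin m) (Fin n ⊕ Fin m) ℂ} {ev : Fin n ⊕ Fin m → ℂ}
    (hQ : IsEigDecomp (matM f zs r) Q ev) (i : Fin n ⊕ Fin m) :
    ((ev i).im = 0 ∧ -(r * L) ≤ (ev i).re ∧ (ev i).re ≤ -min L (lamMin (schur f zs))) ∨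
    ((ev i).re ≤ -L / 2 ∧ (ev i).re ^ 2 + (ev i).im ^ 2 ≤ 3 * r * L ^ 2) := by
  obtain ⟨hdet, hM⟩ := hQ
  -- The columns of Q⁻¹ are eigenvectors of M; real and imaginary parts of one column give the real
  -- equations required by the operator bounds.
  set w : Fin n ⊕ Fin m → ℂ := Q⁻¹ *ᵥ Pi.single i 1 with hw
  have hQw : Q *ᵥ w = Pi.single i 1 := by
    rw [hw, mulVec_mulVec, mul_nonsing_inv _ hdet, one_mulVec]
  have hMw : (matM f zs r).map (fun a : ℝ => (a : ℂ)) *ᵥ w = ev i • w := by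
    rw [hM, ← mulVec_mulVec, hQw, ← mulVec_mulVec, diagonal_mulVec_single, mul_one, hw,
      ← mulVec_smul]
    congr 1
    ext j
    by_cases hj : j = i
    · subst hj; simp
    · simp [hj]
  set e₁ : Pt n m := WithLp.toLp 2 fun j => (w j).re with he₁
  set e₂ : Pt n m := WithLp.toLp 2 fun j => (w j).im with he₂
  have hre : toEuclideanLin (matM f zs r) e₁ = (ev i).re • e₁ - (ev i).im • e₂ := by
    ext j
    have := congrArg Complex.re (congrFun hMw j)
    simpa [mulVec, dotProduct, toLpLin_apply, he₁, he₂] using this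
  have him : toEuclideanLin (matM f zs r) e₂ = (ev i).re • e₂ + (ev i).im • e₁ := by
    ext j
    have := congrArg Complex.im (congrFun hMw j)
    simpa [mulVec, dotProduct, toLpLin_apply, he₁, he₂] using this
  have hne : e₁ ≠ 0 ∨ e₂ ≠ 0 := by
    by_contra! h
    have hw0 : w = 0 := by
      ext j
      apply Complex.ext
      · simpa [he₁] using congrArg (fun z : Pt n m => z j) h.1
      · simpa [he₂] using congrArg (fun z : Pt n m => z j) h.2
    rw [hw0, mulVec_zero] at hQw
    simpa using congrFun hQw i
  have parts {z : Pt n m} (hz : z ≠ 0) : xPart z ≠ 0 ∨ yPart z ≠ 0 := by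
    by_contra! h
    exact hz (eq_zero_of_parts h.1 h.2)
  have x₁ := xPart_matM (f := f) (zs := zs) (r := r) e₁
  have y₁ := yPart_matM (f := f) (zs := zs) (r := r) e₁
  have x₂ := xPart_matM (f := f) (zs := zs) (r := r) e₂
  have y₂ := yPart_matM (f := f) (zs := zs) (r := r) e₂
  rw [hre] at x₁ y₁
  rw [him] at x₂ y₂
  by_cases hb : (ev i).im = 0
  · left
    refine ⟨hb, ?_⟩
    rw [hb, zero_smul, sub_zero] at x₁ y₁
    rw [hb, zero_smul, add_zero] at x₂ y₂
    rcases hne with h | h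
    · exact hS.real_eigenvalue_bounds (parts h) x₁ y₁
    · exact hS.real_eigenvalue_bounds (parts h) x₂ y₂
  · right
    refine hS.nonreal_eigenvalue_bounds (u₁ := xPart e₁) (u₂ := xPart e₂) (v₁ := yPart e₁)
      (v₂ := yPart e₂) hb ?_ x₁ x₂ y₁ y₂
    rcases hne with h | h
    · rcases parts h with h | h <;> simp [h]
    · rcases parts h with h | h <;> simp [h]

end Matrices

/-! ### Contraction in eigenbasis coordinates -/

section EigenbasisNorm

open Matrix

lemma norm_le_of_normSq_le {z : ℂ} {t : ℝ} (ht : t ≤ 1) (h : Complex.normSq z ≤ 1 - 2 * t) :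
    ‖z‖ ≤ 1 - t := by
  refine abs_le_of_sq_le_sq' ?_ (by linarith) |>.2
  rw [← Complex.normSq_eq_norm_sq]
  nlinarith [sq_nonneg t]

/-- Contraction factors of gradient descent ascent and extra-gradient on an eigenvector, in terms of
the scaled eigenvalue `x`. -/
lemma contraction_factors {x : ℂ} {q s : ℝ} (hq : 0 < q) (hqs : q ≤ s) (hs : s ≤ 1 / 2)
    (h : (x.im = 0 ∧ -(1 / 4) ≤ x.re ∧ x.re ≤ -(q / 4)) ∨
      (x.re ≤ -(s / 8) ∧ x.re ^ 2 + x.im ^ 2 ≤ 3 * s / 16)) :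
    ‖x‖ ≤ 1 ∧ ‖1 + x‖ ≤ 1 - q / 32 ∧ ‖1 + x + x ^ 2‖ ≤ 1 - q / 32 := by
  rcases h with ⟨h0, h1, h2⟩ | ⟨h1, h2⟩
  · obtain ⟨a, rfl⟩ : ∃ a : ℝ, x = a := ⟨x.re, Complex.ext rfl (by simpa using h0)⟩
    simp only [Complex.ofReal_re] at h1 h2
    have e1 : (1 : ℂ) + a = ((1 + a : ℝ) : ℂ) := by push_cast; ring
    have e2 : (1 : ℂ) + a + a ^ 2 = ((1 + a + a ^ 2 : ℝ) : ℂ) := by push_cast; ring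
    rw [e2, e1, Complex.norm_real, Complex.norm_real, Complex.norm_real, Real.norm_eq_abs,
      Real.norm_eq_abs, Real.norm_eq_abs]
    refine ⟨abs_le.2 ⟨by linarith, by linarith⟩, abs_le.2 ⟨by linarith, by linarith⟩,
      abs_le.2 ⟨by nlinarith, by nlinarith⟩⟩
  -- Since s ≤ 1/2, the squared modulus is at most 3/32 < 1/9.
  · have ha : -(1 / 3) ≤ x.re := by
      by_contra! hlt
      nlinarith [sq_nonneg x.im]
    refine ⟨?_, norm_le_of_normSq_le (by linarith) ?_, norm_le_of_normSq_le (by linarith) ?_⟩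
    · have := norm_le_of_normSq_le (z := x) (t := 0) (by norm_num)
        (by rw [Complex.normSq_apply]; nlinarith)
      simpa using this
    · rw [Complex.normSq_apply]
      simp only [Complex.add_re, Complex.one_re, Complex.add_im, Complex.one_im]
      nlinarith
    · rw [Complex.normSq_apply]
      simp only [Complex.add_re, Complex.one_re, Complex.add_im, Complex.one_im, pow_two,
        Complex.mul_re, Complex.mul_im]
      set a := x.re
      set b := x.im
      set w := a ^ 2 + b ^ 2 with hw
      have hw0 : 0 ≤ w := by positivity
      have hbw : a ^ 2 ≤ w := by rw [hw]; nlinarith [sq_nonneg b]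
      have e : (1 + a + (a * a - b * b)) * (1 + a + (a * a - b * b))
          + (0 + b + (a * b + b * a)) * (0 + b + (a * b + b * a))
          = 1 + 2 * a + 4 * a ^ 2 - 2 * w + w * (1 + 2 * a + w) := by rw [hw]; ring
      rw [e]
      -- As 2a + w ≤ -s/4 + 3s/16 ≤ 0. With a² ≤ w there remains 1 + 2a + 3a², which is at most 1 +
      -- a for -1/3 ≤ a ≤ 0.
      have h3 : w * (1 + 2 * a + w) ≤ w * 1 :=
        mul_le_mul_of_nonneg_left (by linarith) hw0
      nlinarith

variable {n m : ℕ}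

/-- A real point, viewed as a complex vector. -/
def complexify (e : Pt n m) : EuclideanSpace ℂ (Fin n ⊕ Fin m) :=
  WithLp.toLp 2 fun i => (e i : ℂ)

@[simp] lemma complexify_apply (e : Pt n m) (i : Fin n ⊕ Fin m) : complexify e i = (e i : ℂ) := rfl

lemma complexify_add (e e' : Pt n m) : complexify (e + e') = complexify e + complexify e' := by
  ext i; simp

lemma norm_complexify (e : Pt n m) : ‖complexify e‖ = ‖e‖ := by
  simp [EuclideanSpace.norm_eq]

/-- The norm of the coordinates of a point in the eigenbasis given by `Q`. -/
noncomputable def eigNorm (Q : Matrix (Fin n ⊕ Fin m) (Fin n ⊕ Fin m) ℂ) (e : Pt n m) : ℝ :=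
  ‖toEuclideanLin Q (complexify e)‖

variable {Q : Matrix (Fin n ⊕ Fin m) (Fin n ⊕ Fin m) ℂ}

lemma eigNorm_nonneg (e : Pt n m) : 0 ≤ eigNorm Q e := norm_nonneg _

lemma eigNorm_add_le (e e' : Pt n m) : eigNorm Q (e + e') ≤ eigNorm Q e + eigNorm Q e' := by
  rw [eigNorm, complexify_add, map_add]
  exact norm_add_le _ _

lemma eigNorm_le (e : Pt n m) : eigNorm Q e ≤ specNorm Q * ‖e‖ := by
  rw [← norm_complexify]
  exact norm_toEuclideanLin_le _ _

lemma norm_le_eigNorm (hQ : IsUnit Q.det) (e : Pt n m) : ‖e‖ ≤ specNorm Q⁻¹ * eigNorm Q e := by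
  have h := norm_toEuclideanLin_le Q⁻¹ (toEuclideanLin Q (complexify e))
  rw [← toEuclideanLin_mul_apply, nonsing_inv_mul _ hQ] at h
  simpa [eigNorm, norm_complexify] using h

lemma one_le_condNum (hQ : IsUnit Q.det) {e : Pt n m} (he : e ≠ 0) : 1 ≤ condNum Q := by
  have h1 := norm_le_eigNorm hQ e
  have h2 := mul_le_mul_of_nonneg_left (eigNorm_le (Q := Q) e) (specNorm_nonneg Q⁻¹)
  have h3 : 0 < ‖e‖ := norm_pos_iff.2 he
  rw [condNum]
  by_contra! hlt
  nlinarith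

lemma norm_le_of_forall_apply {ι : Type*} [Fintype ι] {v w : EuclideanSpace ℂ ι} {c : ℝ}
    (hc : 0 ≤ c) (h : ∀ i, ‖v i‖ ≤ c * ‖w i‖) : ‖v‖ ≤ c * ‖w‖ := by
  refine abs_le_of_sq_le_sq' ?_ (by positivity) |>.2
  rw [mul_pow, EuclideanSpace.norm_sq_eq, EuclideanSpace.norm_sq_eq, Finset.mul_sum]
  refine Finset.sum_le_sum fun i _ => ?_
  rw [← mul_pow]
  exact pow_le_pow_left₀ (norm_nonneg _) (h i) 2

lemma eigenbasis_apply {M : Matrix (Fin n ⊕ Fin m) (Fin n ⊕ Fin m) ℝ} {ev : Fin n ⊕ Fin m → ℂ}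
    (hQ : IsEigDecomp M Q ev) (e : Pt n m) (i : Fin n ⊕ Fin m) :
    toEuclideanLin Q (complexify (toEuclideanLin M e)) i
      = ev i * toEuclideanLin Q (complexify e) i := by
  have h1 : complexify (toEuclideanLin M e)
      = toEuclideanLin (M.map (fun a : ℝ => (a : ℂ))) (complexify e) := by
    ext j
    simp [toLpLin_apply, mulVec, dotProduct]
  rw [h1, hQ.2, ← toEuclideanLin_mul_apply, ← mul_assoc, ← mul_assoc, mul_nonsing_inv _ hQ.1,
    one_mul, toEuclideanLin_mul_apply]
  exact mulVec_diagonal ev (toEuclideanLin Q (complexify e)).ofLp i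

variable {M : Matrix (Fin n ⊕ Fin m) (Fin n ⊕ Fin m) ℝ} {ev : Fin n ⊕ Fin m → ℂ} {η q : ℝ}

lemma eigenbasis_smul_apply (hQ : IsEigDecomp M Q ev) (e : Pt n m) (i : Fin n ⊕ Fin m) :
    toEuclideanLin Q (complexify ((η • toEuclideanLin M) e)) i
      = η * ev i * toEuclideanLin Q (complexify e) i := by
  have h : complexify ((η • toEuclideanLin M) e) = (η : ℂ) • complexify (toEuclideanLin M e) := by
    ext j; simp
  rw [h, map_smul, PiLp.smul_apply, eigenbasis_apply hQ, smul_eq_mul, mul_assoc]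

lemma eigNorm_smul_le (hQ : IsEigDecomp M Q ev) (h : ∀ i, ‖η * ev i‖ ≤ 1) (e : Pt n m) :
    eigNorm Q ((η • toEuclideanLin M) e) ≤ eigNorm Q e := by
  have := norm_le_of_forall_apply (v := toEuclideanLin Q (complexify ((η • toEuclideanLin M) e)))
    (w := toEuclideanLin Q (complexify e)) zero_le_one fun i => by
      rw [eigenbasis_smul_apply hQ, norm_mul]
      exact mul_le_mul_of_nonneg_right (h i) (norm_nonneg _)
  rwa [one_mul] at this

lemma eigNorm_one_add_le (hQ : IsEigDecomp M Q ev) {c : ℝ} (hc : 0 ≤ c)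
    (h : ∀ i, ‖1 + η * ev i‖ ≤ c) (e : Pt n m) :
    eigNorm Q (e + (η • toEuclideanLin M) e) ≤ c * eigNorm Q e := by
  refine norm_le_of_forall_apply hc fun i => ?_
  rw [complexify_add, map_add, PiLp.add_apply, eigenbasis_smul_apply hQ, ← one_add_mul, norm_mul]
  exact mul_le_mul_of_nonneg_right (h i) (norm_nonneg _)

lemma eigNorm_one_add_sq_le (hQ : IsEigDecomp M Q ev) {c : ℝ} (hc : 0 ≤ c)
    (h : ∀ i, ‖1 + η * ev i + (η * ev i) ^ 2‖ ≤ c) (e : Pt n m) :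
    eigNorm Q (e + (η • toEuclideanLin M) e + (η • toEuclideanLin M) ((η • toEuclideanLin M) e))
      ≤ c * eigNorm Q e := by
  refine norm_le_of_forall_apply hc fun i => ?_
  rw [complexify_add, map_add, PiLp.add_apply, complexify_add, map_add, PiLp.add_apply,
    eigenbasis_smul_apply hQ, eigenbasis_smul_apply hQ, eigenbasis_smul_apply hQ]
  calc _ = ‖(1 + η * ev i + (η * ev i) ^ 2) * toEuclideanLin Q (complexify e) i‖ := by
        congr 1; ring
    _ ≤ _ := by rw [norm_mul]; exact mul_le_mul_of_nonneg_right (h i) (norm_nonneg _)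

end EigenbasisNorm

/-! ### Perturbed contractions along a noise path -/

section Dynamics

/-- A bootstrap: the recursion is available only while a k and w k stay below R, and the total
budget `hR`, combined with the bound already proved at k, guarantees just that. Past noise is kept
undamped. -/
lemma le_geometric_add_sum {a w : ℕ → ℝ} {ρ R : ℝ} {T : ℕ} (ha : ∀ k, 0 ≤ a k)
    (hw : ∀ k, 0 ≤ w k) (hρ0 : 0 ≤ ρ) (hρ1 : ρ ≤ 1)
    (hstep : ∀ k, a k ≤ R → w k ≤ R → a (k + 1) ≤ ρ * a k + w k)
    (hR : a 0 + ∑ k ∈ Finset.range T, w k ≤ R) :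
    ∀ k ≤ T, a k ≤ ρ ^ k * a 0 + ∑ j ∈ Finset.range k, w j := by
  intro k
  induction k with
  | zero => intro _; simp
  | succ k ih =>
    intro hk
    have hsum : ∑ j ∈ Finset.range (k + 1), w j ≤ ∑ j ∈ Finset.range T, w j :=
      Finset.sum_le_sum_of_subset_of_nonneg (Finset.range_mono hk) fun i _ _ => hw i
    have hs0 : 0 ≤ ∑ j ∈ Finset.range k, w j := Finset.sum_nonneg fun i _ => hw i
    rw [Finset.sum_range_succ] at hsum ⊢
    have h1 := ih (by omega)
    have h2 : ρ ^ k * a 0 ≤ a 0 := mul_le_of_le_one_left (ha 0) (pow_le_one₀ hρ0 hρ1)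
    have h3 := hstep k (by linarith [hw k]) (by linarith [ha 0])
    have h4 := mul_le_mul_of_nonneg_left h1 hρ0
    have h5 := mul_le_of_le_one_left hs0 hρ1
    rw [pow_succ]
    linarith

/-- Near `zs`, the update direction `D ∘ F` is a small perturbation of a linear field `G` for which
gradient and extra-gradient steps contract the gauge `N`. -/
structure LocallyContracting {E : Type*} [NormedAddCommGroup E] [Module ℝ E]
    (F : E → E) (D G : E →ₗ[ℝ] E) (N : E → ℝ) (zs : E) (c h δ τ : ℝ) : Prop where
  nonneg : ∀ e, 0 ≤ N e
  add_le : ∀ e e', N (e + e') ≤ N e + N e'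
  norm_le : ∀ e, ‖e‖ ≤ c * N e
  apply_D_le : ∀ e, N (D e) ≤ h * ‖e‖
  apply_G_le : ∀ e, N (G e) ≤ N e
  one_add_le : ∀ e, N (e + G e) ≤ (1 - τ / 32) * N e
  one_add_sq_le : ∀ e, N (e + G e + G (G e)) ≤ (1 - τ / 32) * N e
  remainder_le : ∀ z, ‖z - zs‖ ≤ δ → N (D (F z) - G (z - zs)) ≤ τ / 192 * N (z - zs)
  c_nonneg : 0 ≤ c
  h_nonneg : 0 ≤ h
  tau_nonneg : 0 ≤ τ
  tau_le_one : τ ≤ 1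

namespace LocallyContracting

variable {E : Type*} [NormedAddCommGroup E] [Module ℝ E] {F : E → E} {D G : E →ₗ[ℝ] E}
  {N : E → ℝ} {zs : E} {c h δ τ : ℝ}

lemma gradient_step_le (H : LocallyContracting F D G N zs c h δ τ) {z ξ : E}
    (hz : ‖z - zs‖ ≤ δ) :
    N (z + D (F z + ξ) - zs) ≤ (1 - τ / 64) * N (z - zs) + h * ‖ξ‖ := by
  have e : z + D (F z + ξ) - zs
      = (z - zs + G (z - zs)) + ((D (F z) - G (z - zs)) + D ξ) := by
    rw [map_add]; abel
  rw [e]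
  have h1 := H.add_le (z - zs + G (z - zs)) ((D (F z) - G (z - zs)) + D ξ)
  have h2 := H.add_le (D (F z) - G (z - zs)) (D ξ)
  have h3 := H.remainder_le z hz
  have h4 := H.apply_D_le ξ
  have h5 := H.one_add_le (z - zs)
  have h6 := mul_nonneg H.tau_nonneg (H.nonneg (z - zs))
  linarith

/-- Substituting the half step into the linear model produces e + Ge + G²e with e = z - zs, together
with two remainders, each worth τ/192 up to noise. Their total τ/96 fits into the gap between τ/32
and τ/64. -/
lemma extragradient_step_le (H : LocallyContracting F D G N zs c h δ τ) {z z' ξ ξ' : E}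
    (hz : ‖z - zs‖ ≤ δ) (hz' : ‖z' - zs‖ ≤ δ) (e' : z' = z + D (F z + ξ)) :
    N (z + D (F z' + ξ') - zs)
      ≤ (1 - τ / 64) * N (z - zs) + h * (2 * ‖ξ‖ + ‖ξ'‖) := by
  have e : z + D (F z' + ξ') - zs
      = (z - zs + G (z - zs) + G (G (z - zs))) + (G (D (F z) - G (z - zs)) +
        (G (D ξ) + ((D (F z') - G (z' - zs)) + D ξ'))) := by
    have : z' - zs = (z - zs) + D (F z) + D ξ := by rw [e', map_add]; abel
    rw [this]
    simp only [map_add, map_sub]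
    abel
  rw [e]
  have a1 := H.add_le (z - zs + G (z - zs) + G (G (z - zs))) (G (D (F z) - G (z - zs)) +
        (G (D ξ) + ((D (F z') - G (z' - zs)) + D ξ')))
  have a2 := H.add_le (G (D (F z) - G (z - zs))) (G (D ξ) + ((D (F z') - G (z' - zs)) + D ξ'))
  have a3 := H.add_le (G (D ξ)) ((D (F z') - G (z' - zs)) + D ξ')
  have a4 := H.add_le (D (F z') - G (z' - zs)) (D ξ')
  have h1 := H.one_add_sq_le (z - zs)
  have h2 := (H.apply_G_le (D (F z) - G (z - zs))).trans (H.remainder_le z hz)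
  have h3 := (H.apply_G_le (D ξ)).trans (H.apply_D_le ξ)
  have h4 := H.remainder_le z' hz'
  have h5 := H.apply_D_le ξ'
  have h6 := H.gradient_step_le (ξ := ξ) hz
  rw [← e'] at h6
  have hτ := H.tau_nonneg
  have hτ1 := H.tau_le_one
  have hN := H.nonneg (z - zs)
  have hhξ := mul_nonneg H.h_nonneg (norm_nonneg ξ)
  have h7 : τ / 192 * N (z' - zs) ≤ τ / 192 * N (z - zs) + h * ‖ξ‖ := by
    have b1 := mul_le_mul_of_nonneg_left h6 (by positivity : 0 ≤ τ / 192)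
    have b2 : τ / 192 * (h * ‖ξ‖) ≤ h * ‖ξ‖ := mul_le_of_le_one_left hhξ (by linarith)
    have b3 : 0 ≤ τ / 192 * (τ / 64 * N (z - zs)) := by positivity
    linarith
  have h8 : 0 ≤ τ * N (z - zs) := by positivity
  linarith

lemma sum_range_pairs (x : ℕ → ℝ) (T : ℕ) :
    ∑ k ∈ Finset.range T, (x (2 * k) + x (2 * k + 1)) = ∑ j ∈ Finset.range (2 * T), x j := by
  induction T with
  | zero => simp
  | succ T ih =>
    rw [Finset.sum_range_succ, ih, mul_add, mul_one, Finset.sum_range_succ, Finset.sum_range_succ]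
    ring

lemma gradient_iterates_le (H : LocallyContracting F D G N zs c h δ τ) {z ξ : ℕ → E} {R : ℝ}
    {T : ℕ} (hz : ∀ k, z (k + 1) = z k + D (F (z k) + ξ k)) (hδ : c * (2 * R) ≤ δ)
    (hR : N (z 0 - zs) + 2 * h * ∑ j ∈ Finset.range (2 * T), ‖ξ j‖ ≤ R) :
    N (z T - zs)
      ≤ (1 - τ / 64) ^ T * N (z 0 - zs) + 2 * h * ∑ j ∈ Finset.range (2 * T), ‖ξ j‖ := by
  have hh := H.h_nonneg
  -- The factor 2 and the range 2T are wasteful here; they give both algorithms the same noise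
  -- budget.
  have hsum : ∑ k ∈ Finset.range T, h * ‖ξ k‖ ≤ 2 * h * ∑ j ∈ Finset.range (2 * T), ‖ξ j‖ := by
    rw [← Finset.mul_sum]
    have h1 : ∑ k ∈ Finset.range T, ‖ξ k‖ ≤ ∑ j ∈ Finset.range (2 * T), ‖ξ j‖ :=
      Finset.sum_le_sum_of_subset_of_nonneg (Finset.range_mono (by omega)) fun _ _ _ =>
        norm_nonneg _
    have h2 := mul_le_mul_of_nonneg_left h1 hh
    have h3 : 0 ≤ h * ∑ j ∈ Finset.range (2 * T), ‖ξ j‖ := by positivity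
    linarith
  have hmain := le_geometric_add_sum (a := fun k => N (z k - zs)) (w := fun k => h * ‖ξ k‖)
    (ρ := 1 - τ / 64) (R := R) (T := T) (fun k => H.nonneg _) (fun k => by positivity)
    (by linarith [H.tau_le_one]) (by linarith [H.tau_nonneg])
    (fun k hk hw => ?_) (by linarith) T le_rfl
  · exact hmain.trans (by linarith)
  · have hR0 : 0 ≤ R := (H.nonneg _).trans hk
    have := mul_le_mul_of_nonneg_left (hk.trans (by linarith : R ≤ 2 * R)) H.c_nonneg
    simp only [hz]
    exact H.gradient_step_le ((H.norm_le _).trans (this.trans hδ))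

lemma extragradient_iterates_le (H : LocallyContracting F D G N zs c h δ τ) {z z' ξ : ℕ → E}
    {R : ℝ} {T : ℕ} (hz' : ∀ k, z' k = z k + D (F (z k) + ξ (2 * k)))
    (hz : ∀ k, z (k + 1) = z k + D (F (z' k) + ξ (2 * k + 1))) (hδ : c * (2 * R) ≤ δ)
    (hR : N (z 0 - zs) + 2 * h * ∑ j ∈ Finset.range (2 * T), ‖ξ j‖ ≤ R) :
    N (z T - zs)
      ≤ (1 - τ / 64) ^ T * N (z 0 - zs) + 2 * h * ∑ j ∈ Finset.range (2 * T), ‖ξ j‖ := by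
  have hh := H.h_nonneg
  have hsum : ∑ k ∈ Finset.range T, h * (2 * ‖ξ (2 * k)‖ + ‖ξ (2 * k + 1)‖)
      ≤ 2 * h * ∑ j ∈ Finset.range (2 * T), ‖ξ j‖ := by
    rw [← sum_range_pairs (fun j => ‖ξ j‖), Finset.mul_sum]
    refine Finset.sum_le_sum fun k _ => ?_
    have : 0 ≤ h * ‖ξ (2 * k + 1)‖ := by positivity
    linarith
  have hmain := le_geometric_add_sum (a := fun k => N (z k - zs))
    (w := fun k => h * (2 * ‖ξ (2 * k)‖ + ‖ξ (2 * k + 1)‖))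
    (ρ := 1 - τ / 64) (R := R) (T := T) (fun k => H.nonneg _) (fun k => by positivity)
    (by linarith [H.tau_le_one]) (by linarith [H.tau_nonneg])
    (fun k hk hw => ?_) (by linarith) T le_rfl
  · exact hmain.trans (by linarith)
  · have hR0 : 0 ≤ R := (H.nonneg _).trans hk
    have h1 := mul_le_mul_of_nonneg_left (hk.trans (by linarith : R ≤ 2 * R)) H.c_nonneg
    have hzδ : ‖z k - zs‖ ≤ δ := (H.norm_le _).trans (h1.trans hδ)
    -- The half step adds at most one noise term, itself at most R, to a gauge at most R; hence the
    -- radius 2R in `hδ`.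
    have hz'δ : ‖z' k - zs‖ ≤ δ := by
      have h2 := H.gradient_step_le (ξ := ξ (2 * k)) hzδ
      rw [← hz'] at h2
      have h3 : 0 ≤ τ * N (z k - zs) := mul_nonneg H.tau_nonneg (H.nonneg _)
      have h4 : 0 ≤ h * ‖ξ (2 * k)‖ := by positivity
      have h5 : 0 ≤ h * ‖ξ (2 * k + 1)‖ := by positivity
      have h6 : N (z' k - zs) ≤ 2 * R := by linarith
      exact (H.norm_le _).trans ((mul_le_mul_of_nonneg_left h6 H.c_nonneg).trans hδ)
    simp only [hz]
    exact H.extragradient_step_le hzδ hz'δ (hz' k)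

end LocallyContracting

end Dynamics

/-! ### Linearization of the update at the equilibrium -/

section Linearization

open Matrix Filter Topology

variable {n m : ℕ} {f : Pt n m → ℝ} {U : Set (Pt n m)} {zs : Pt n m} {L r : ℝ}

lemma gradient_eq_zero (hz : IsDiffStackelberg f zs) : gradient f zs = 0 :=
  eq_zero_of_parts hz.grad_x hz.grad_y

/-- The gradient is differentiable at `zs`, with derivative the Hessian. -/
lemma hasFDerivAt_gradient (hf : ContDiffAt ℝ 2 f zs) :
    HasFDerivAt (gradient f) (toEuclideanLin (hessian f zs)).toContinuousLinearMap zs := by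
  have hsymm := hf.isSymmSndFDerivAt (by simp)
  have h1 : HasFDerivAt (fderiv ℝ f) (fderiv ℝ (fderiv ℝ f) zs) zs :=
    ((hf.fderiv_right (m := 1) (by norm_num)).differentiableAt one_ne_zero).hasFDerivAt
  have h2 := ((InnerProductSpace.toDual ℝ
    (Pt n m)).symm.toContinuousLinearEquiv.toContinuousLinearMap).hasFDerivAt.comp zs h1
  refine h2.congr_fderiv ?_
  ext e i
  have h3 : ((InnerProductSpace.toDual ℝ (Pt n m)).symm (fderiv ℝ (fderiv ℝ f) zs e)) i
      = fderiv ℝ (fderiv ℝ f) zs e (EuclideanSpace.single i 1) := by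
    rw [← InnerProductSpace.toDual_symm_apply, EuclideanSpace.inner_single_right]
    simp
  -- Symmetry of the second derivative moves the index i to the slot that it has in `hessian`.
  have h4 : fderiv ℝ (fderiv ℝ f) zs e (EuclideanSpace.single i 1)
      = fderiv ℝ (fderiv ℝ f) zs (EuclideanSpace.single i 1) e := hsymm _ _
  have h5 : e = ∑ j, e j • EuclideanSpace.single j (1 : ℝ) := by
    simpa using ((EuclideanSpace.basisFun (Fin n ⊕ Fin m) ℝ).sum_repr e).symm
  have h6 : fderiv ℝ (fderiv ℝ f) zs (EuclideanSpace.single i 1) e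
      = ∑ j, e j * fderiv ℝ (fderiv ℝ f) zs (EuclideanSpace.single i 1)
        (EuclideanSpace.single j 1) := by
    conv_lhs => rw [h5, map_sum]
    simp
  calc _ = fderiv ℝ (fderiv ℝ f) zs e (EuclideanSpace.single i 1) := h3
    _ = _ := by
      rw [h4, h6]
      simp only [LinearMap.coe_toContinuousLinearMap', toLpLin_apply, mulVec, dotProduct, hessian,
        of_apply]
      exact Finset.sum_congr rfl fun j _ => mul_comm _ _

lemma hessian_transpose (hf : ContDiffAt ℝ 2 f zs) : (hessian f zs)ᵀ = hessian f zs := by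
  ext i j
  exact hf.isSymmSndFDerivAt (by simp) _ _

/-- The update direction `g ↦ (-η_x g_x, η_y g_y)`. -/
noncomputable def updateDir (n m : ℕ) (ηx ηy : ℝ) : Pt n m →ₗ[ℝ] Pt n m where
  toFun g := mkPt (-(ηx • xPart g)) (ηy • yPart g)
  map_add' g g' := by
    ext i
    rcases i with i | i <;> simp [mul_add, add_comm]
  map_smul' c g := by
    ext i
    rcases i with i | i <;> simp [mul_left_comm]

lemma step_eq_add (ηx ηy : ℝ) (z g : Pt n m) : step ηx ηy z g = z + updateDir n m ηx ηy g := by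
  ext i
  rcases i with i | i <;> simp [step, updateDir, sub_eq_add_neg]

lemma norm_updateDir_le {ηx ηy : ℝ} (hx : 0 ≤ ηx) (hxy : ηx ≤ ηy) (g : Pt n m) :
    ‖updateDir n m ηx ηy g‖ ≤ ηy * ‖g‖ := by
  refine abs_le_of_sq_le_sq' ?_ (mul_nonneg (hx.trans hxy) (norm_nonneg _)) |>.2
  have e1 : xPart (updateDir n m ηx ηy g) = -(ηx • xPart g) := rfl
  have e2 : yPart (updateDir n m ηx ηy g) = ηy • yPart g := rfl
  rw [norm_sq_eq_parts, mul_pow, norm_sq_eq_parts g, e1, e2, norm_neg, norm_smul, norm_smul,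
    mul_pow, mul_pow, Real.norm_eq_abs, Real.norm_eq_abs, sq_abs, sq_abs, mul_add]
  gcongr

lemma updateDir_hessian (hf : ContDiffAt ℝ 2 f zs) (η : ℝ) (e : Pt n m) :
    updateDir n m η (r * η) (toEuclideanLin (hessian f zs) e)
      = (η • toEuclideanLin (matM f zs r)) e := by
  have hs (i j) : hessian f zs i j = hessian f zs j i :=
    congrFun (congrFun (hessian_transpose hf) j) i
  ext i
  rcases i with i | i
  · simp [updateDir, matM, blockC, blockB, toLpLin_apply, mulVec, dotProduct, toBlocks₁₁,
      toBlocks₁₂]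
    ring
  · simp [updateDir, matM, blockA, blockB, toLpLin_apply, mulVec, dotProduct, toBlocks₂₂,
      toBlocks₁₂, Finset.mul_sum, hs (Sum.inr _) (Sum.inl _), mul_add]
    congr 1 <;> exact Finset.sum_congr rfl fun _ _ => by ring

lemma exists_locallyContracting (hU : IsOpen U) (hzU : zs ∈ U) (hf : ContDiffOn ℝ 2 f U)
    (hz : IsDiffStackelberg f zs)
    (hS : StackelbergBlocks (toEuclideanLin (blockA f zs))
      (toEuclideanLin (blockB f zs)) (toEuclideanLin (blockB f zs)ᵀ) (toEuclideanLin (blockC f zs))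
      L (lamMin (blockA f zs)) (min L (lamMin (schur f zs))) r)
    {Q : Matrix (Fin n ⊕ Fin m) (Fin n ⊕ Fin m) ℂ} {ev : Fin n ⊕ Fin m → ℂ}
    (hQ : IsEigDecomp (matM f zs r) Q ev) :
    ∃ δ > 0, LocallyContracting (gradient f) (updateDir n m (1 / (4 * r * L)) (1 / (4 * L)))
      ((1 / (4 * r * L)) • toEuclideanLin (matM f zs r)) (eigNorm Q) zs (specNorm Q⁻¹)
      (specNorm Q * (1 / (4 * L))) δ (1 / (r * kappaX f zs L)) := by
  have hL := hS.L_pos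
  have hr2 := hS.two_le
  have hr : 0 < r := by linarith
  have hx := hS.mux_pos
  have hxL := hS.mux_le
  set μx := min L (lamMin (schur f zs)) with hμx
  set η : ℝ := 1 / (4 * r * L) with hη
  have hη0 : 0 < η := by positivity
  have hrη : 1 / (4 * L) = r * η := by rw [hη]; field_simp
  set τ : ℝ := 1 / (r * kappaX f zs L) with hτ
  have hτ' : τ = μx / (r * L) := by rw [hτ, kappaX, ← hμx]; field_simp
  have hτ0 : 0 < τ := by rw [hτ']; positivity
  have hτs : τ ≤ 1 / r := by
    rw [hτ', div_le_div_iff₀ (by positivity) hr]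
    nlinarith
  have hrinv : 1 / r ≤ 1 / 2 := by gcongr
  have hxev (i) : ‖η * ev i‖ ≤ 1 ∧ ‖1 + η * ev i‖ ≤ 1 - τ / 32 ∧
      ‖1 + η * ev i + (η * ev i) ^ 2‖ ≤ 1 - τ / 32 := by
    -- With s = 1/r, scaling by η turns -rL, -μx, -L/2 and 3rL² (by η²) into -1/4, -τ/4, -s/8 and
    -- 3s/16.
    refine contraction_factors hτ0 hτs hrinv ?_
    have hre : ((η : ℂ) * ev i).re = η * (ev i).re := by simp
    have him : ((η : ℂ) * ev i).im = η * (ev i).im := by simp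
    rw [hre, him]
    rcases eigenvalue_bounds hS hQ i with ⟨h0, h1, h2⟩ | ⟨h1, h2⟩
    · left
      refine ⟨by rw [h0, mul_zero], ?_, ?_⟩
      · have := mul_le_mul_of_nonneg_left h1 hη0.le
        have e : η * -(r * L) = -(1 / 4) := by rw [hη]; field_simp
        linarith
      · have := mul_le_mul_of_nonneg_left h2 hη0.le
        have e : η * -μx = -(τ / 4) := by rw [hη, hτ']; field_simp
        linarith
    · right
      constructor
      · have := mul_le_mul_of_nonneg_left h1 hη0.le
        have e : η * (-L / 2) = -(1 / r / 8) := by rw [hη]; field_simp; norm_num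
        linarith
      · have := mul_le_mul_of_nonneg_left h2 (sq_nonneg η)
        have e : η ^ 2 * (3 * r * L ^ 2) = 3 * (1 / r) / 16 := by rw [hη]; field_simp; norm_num
        linarith
  have hcd : ContDiffAt ℝ 2 f zs := hf.contDiffAt (hU.mem_nhds hzU)
  have hQ0 := specNorm_nonneg Q
  have hQi0 := specNorm_nonneg Q⁻¹
  -- Precision of the linearization: the step size 1/(4L) and the change of norm C_P amplify it to
  -- at most τ/192. The added 1 keeps the denominator visibly positive.
  set ω : ℝ := τ / (192 * (condNum Q / (4 * L) + 1)) with hω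
  have hCP0 : 0 ≤ condNum Q := mul_nonneg hQ0 hQi0
  have hω0 : 0 < ω := by positivity
  have hlin := (hasFDerivAt_gradient hcd).isLittleO.bound hω0
  obtain ⟨δ, hδ, hball⟩ := Metric.nhds_basis_closedBall.eventually_iff.1 hlin
  refine ⟨δ, hδ, eigNorm_nonneg, eigNorm_add_le, norm_le_eigNorm hQ.1, fun e => ?_,
    eigNorm_smul_le hQ fun i => (hxev i).1,
    eigNorm_one_add_le hQ (by linarith) fun i => (hxev i).2.1,
    eigNorm_one_add_sq_le hQ (by linarith) fun i => (hxev i).2.2, fun z hzδ => ?_,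
    hQi0, by positivity, hτ0.le, by linarith⟩
  · rw [mul_assoc]
    refine (eigNorm_le _).trans (mul_le_mul_of_nonneg_left ?_ hQ0)
    refine norm_updateDir_le hη0.le ?_ e
    rw [hrη]; nlinarith
  · have h1 := hball (by simpa [dist_eq_norm] using hzδ : z ∈ Metric.closedBall zs δ)
    rw [gradient_eq_zero hz, sub_zero] at h1
    have h2 : updateDir n m η (1 / (4 * L)) (gradient f z)
        - (η • toEuclideanLin (matM f zs r)) (z - zs)
        = updateDir n m η (1 / (4 * L))
          (gradient f z - toEuclideanLin (hessian f zs) (z - zs)) := by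
      rw [map_sub (updateDir n m η (1 / (4 * L))), hrη, updateDir_hessian hcd]
    rw [h2]
    have h3 := norm_updateDir_le (n := n) (m := m) (ηy := 1 / (4 * L)) hη0.le
      (by rw [hrη]; nlinarith) (gradient f z - toEuclideanLin (hessian f zs) (z - zs))
    have h4 := norm_le_eigNorm hQ.1 (z - zs)
    have hN := eigNorm_nonneg (Q := Q) (z - zs)
    calc _ ≤ specNorm Q * (1 / (4 * L) * (ω * (specNorm Q⁻¹ * eigNorm Q (z - zs)))) := by
          refine (eigNorm_le _).trans (mul_le_mul_of_nonneg_left (h3.trans ?_) hQ0)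
          refine mul_le_mul_of_nonneg_left (h1.trans ?_) (by positivity)
          exact mul_le_mul_of_nonneg_left h4 hω0.le
      _ = (condNum Q / (4 * L)) * ω * eigNorm Q (z - zs) := by rw [condNum]; ring
      _ ≤ τ / 192 * eigNorm Q (z - zs) := by
          refine mul_le_mul_of_nonneg_right ?_ hN
          have : (condNum Q / (4 * L) + 1) * ω = τ / 192 := by rw [hω]; field_simp
          linarith

end Linearization

/-! ### Tail bound for the total noise -/

section Noise

variable {n m : ℕ} {Ω : Type*} [MeasurableSpace Ω] {P : Measure Ω} {σ : ℝ} {S : ℕ}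
  {ξ : ℕ → Ω → Pt n m}

lemma continuous_xPart : Continuous (xPart : Pt n m → EuclideanSpace ℝ (Fin n)) := by
  unfold xPart; fun_prop

lemma continuous_yPart : Continuous (yPart : Pt n m → EuclideanSpace ℝ (Fin m)) := by
  unfold yPart; fun_prop

lemma IsMiniBatchNoise.integral_norm_sq_le (h : IsMiniBatchNoise P σ S ξ) (j : ℕ) :
    ∫ ω, ‖ξ j ω‖ ^ 2 ∂P ≤ 2 * σ ^ 2 / S := by
  have hm := (h.memLp j).aestronglyMeasurable
  have hint : Integrable (fun ω => ‖ξ j ω‖ ^ 2) P := (h.memLp j).integrable_norm_pow two_ne_zero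
  have hix : Integrable (fun ω => ‖xPart (ξ j ω)‖ ^ 2) P := by
    refine hint.mono' ((continuous_xPart.comp_aestronglyMeasurable hm).norm.pow 2)
      (Filter.Eventually.of_forall fun ω => ?_)
    rw [Real.norm_of_nonneg (by positivity), norm_sq_eq_parts (ξ j ω)]
    exact le_add_of_nonneg_right (by positivity)
  have hiy : Integrable (fun ω => ‖yPart (ξ j ω)‖ ^ 2) P := by
    refine hint.mono' ((continuous_yPart.comp_aestronglyMeasurable hm).norm.pow 2)
      (Filter.Eventually.of_forall fun ω => ?_)
    rw [Real.norm_of_nonneg (by positivity), norm_sq_eq_parts (ξ j ω)]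
    exact le_add_of_nonneg_left (by positivity)
  simp_rw [norm_sq_eq_parts]
  rw [integral_add hix hiy, mul_div_assoc, two_mul]
  exact add_le_add (h.var_x j) (h.var_y j)

/-- With high probability the total noise of the first `N` queries is small. -/
lemma IsMiniBatchNoise.one_sub_le_measureReal_sum_le [IsProbabilityMeasure P]
    (h : IsMiniBatchNoise P σ S ξ) (N : ℕ) {a : ℝ} (ha : 0 < a) :
    1 - (N : ℝ) ^ 2 * (2 * σ ^ 2 / S) / a ^ 2
      ≤ P.real {ω | ∑ j ∈ Finset.range N, ‖ξ j ω‖ ≤ a} := by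
  -- By Cauchy–Schwarz, V dominates the square of the sum of norms, and Markov's inequality applies
  -- to V.
  set V : Ω → ℝ := fun ω => N * ∑ j ∈ Finset.range N, ‖ξ j ω‖ ^ 2 with hV
  have hint (j : ℕ) : Integrable (fun ω => ‖ξ j ω‖ ^ 2) P :=
    (h.memLp j).integrable_norm_pow two_ne_zero
  have hVint : Integrable V P := (integrable_finsetSum _ fun j _ => hint j).const_mul _
  have hEV : ∫ ω, V ω ∂P ≤ (N : ℝ) ^ 2 * (2 * σ ^ 2 / S) := by
    rw [hV, integral_const_mul, integral_finsetSum _ fun j _ => hint j, pow_two, mul_assoc]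
    refine mul_le_mul_of_nonneg_left ?_ (Nat.cast_nonneg N)
    calc _ ≤ ∑ _j ∈ Finset.range N, 2 * σ ^ 2 / (S : ℝ) :=
          Finset.sum_le_sum fun j _ => h.integral_norm_sq_le j
      _ = _ := by simp
  have hmarkov := mul_meas_ge_le_integral_of_nonneg (μ := P) (f := V)
    (Filter.Eventually.of_forall fun ω => by simp only [hV, Pi.zero_apply]; positivity) hVint
    (a ^ 2)
  have hcover : (Set.univ : Set Ω)
      ⊆ {ω | ∑ j ∈ Finset.range N, ‖ξ j ω‖ ≤ a} ∪ {ω | a ^ 2 ≤ V ω} := by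
    intro ω _
    by_cases hω : ∑ j ∈ Finset.range N, ‖ξ j ω‖ ≤ a
    · exact Or.inl hω
    · right
      have h1 : a ^ 2 ≤ (∑ j ∈ Finset.range N, ‖ξ j ω‖) ^ 2 :=
        pow_le_pow_left₀ ha.le (not_le.1 hω).le 2
      have h2 := sq_sum_le_card_mul_sum_sq (s := Finset.range N) (f := fun j => ‖ξ j ω‖)
      rw [Finset.card_range] at h2
      exact h1.trans h2
  have h1 := (measureReal_mono (μ := P) hcover).trans (measureReal_union_le _ _)
  rw [probReal_univ] at h1
  have h2 : P.real {ω | a ^ 2 ≤ V ω} ≤ (N : ℝ) ^ 2 * (2 * σ ^ 2 / S) / a ^ 2 := by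
    rw [le_div_iff₀ (by positivity), mul_comm]
    exact hmarkov.trans hEV
  linarith

end Noise

/-! ### Iterates in additive form, iteration count and cost -/

section Complexity

variable {n m : ℕ} {Ω : Type*} {f : Pt n m → ℝ} {g : ℕ → Ω → Pt n m → Pt n m} {ηx ηy : ℝ}
  {z₀ : Pt n m}

lemma sgda_succ (k : ℕ) (ω : Ω) :
    sgda g ηx ηy z₀ (k + 1) ω = sgda g ηx ηy z₀ k ω + updateDir n m ηx ηy
      (gradient f (sgda g ηx ηy z₀ k ω) + noise f g (sgda g ηx ηy z₀) k ω) := by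
  rw [noise, add_sub_cancel, ← step_eq_add, sgda]

lemma segQuery_even (k : ℕ) (ω : Ω) : segQuery g ηx ηy z₀ (2 * k) ω = seg g ηx ηy z₀ k ω := by
  simp [segQuery]

lemma segQuery_odd (k : ℕ) (ω : Ω) :
    segQuery g ηx ηy z₀ (2 * k + 1) ω = seg g ηx ηy z₀ k ω + updateDir n m ηx ηy
      (gradient f (seg g ηx ηy z₀ k ω) + noise f g (segQuery g ηx ηy z₀) (2 * k) ω) := by
  have h1 : (2 * k + 1) / 2 = k := by omega
  have h2 : (2 * k + 1) % 2 = 1 := by omega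
  rw [noise, segQuery_even, add_sub_cancel, ← step_eq_add, segQuery, h1, h2, if_neg one_ne_zero]

lemma seg_succ (k : ℕ) (ω : Ω) :
    seg g ηx ηy z₀ (k + 1) ω = seg g ηx ηy z₀ k ω + updateDir n m ηx ηy
      (gradient f (segQuery g ηx ηy z₀ (2 * k + 1) ω)
        + noise f g (segQuery g ηx ηy z₀) (2 * k + 1) ω) := by
  rw [noise, add_sub_cancel, segQuery_odd (f := f), noise, segQuery_even, add_sub_cancel,
    ← step_eq_add, ← step_eq_add, seg]

/-- After `T ≥ 128 ℓ / τ` steps the contraction factor is below the target accuracy. -/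
lemma geometric_mul_le {τ C ε ℓ : ℝ} {T : ℕ} (hτ0 : 0 < τ) (hτ1 : τ ≤ 1) (hε : 0 < ε)
    (hC : 0 < C) (hℓ1 : 1 ≤ ℓ) (hℓ : Real.log (C / ε) ≤ ℓ) (hT : 128 * ℓ / τ ≤ T) :
    (1 - τ / 64) ^ T * C ≤ ε / 2 := by
  have h1 : (1 - τ / 64) ^ T ≤ Real.exp (-(2 * ℓ)) := by
    calc (1 - τ / 64) ^ T ≤ Real.exp (-(τ / 64)) ^ T :=
          pow_le_pow_left₀ (by linarith) (by linarith [Real.add_one_le_exp (-(τ / 64))]) T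
      _ = Real.exp (-(T * (τ / 64))) := by rw [← Real.exp_nat_mul]; ring_nf
      _ ≤ _ := by
          rw [div_le_iff₀ hτ0] at hT
          exact Real.exp_le_exp.2 (by linarith)
  -- One copy of ℓ absorbs the logarithm and turns C into ε; the other, being at least 1, supplies
  -- the factor e⁻¹ ≤ 1/2.
  have h2 : Real.exp (-(2 * ℓ)) ≤ Real.exp (-1) * Real.exp (-Real.log (C / ε)) := by
    rw [← Real.exp_add]
    exact Real.exp_le_exp.2 (by linarith)
  have h3 : Real.exp (-Real.log (C / ε)) * C = ε := by
    rw [Real.exp_neg, Real.exp_log (by positivity)]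
    field_simp
  have h4 : Real.exp (-1) ≤ 1 / 2 := by
    rw [Real.exp_neg, ← one_div]
    exact one_div_le_one_div_of_le (by norm_num) (by linarith [Real.add_one_le_exp (1 : ℝ)])
  calc (1 - τ / 64) ^ T * C
      ≤ Real.exp (-1) * Real.exp (-Real.log (C / ε)) * C :=
        mul_le_mul_of_nonneg_right (h1.trans h2) hC.le
    _ = Real.exp (-1) * ε := by rw [mul_assoc, h3]
    _ ≤ ε / 2 := by nlinarith

lemma cost_le {X b K : ℝ} {T S : ℕ} (hX : 1 ≤ X) (hb : 0 ≤ b) (hK : 0 < K) (hT : (T : ℝ) ≤ 129 * X)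
    (hS : S = max 1 ⌈K * b⌉₊) :
    (sgdaCost T S : ℝ) ≤ 258 * (K + 1) * (X * max 1 b) ∧
      (segCost T S : ℝ) ≤ 258 * (K + 1) * (X * max 1 b) := by
  have hS' : (S : ℝ) ≤ (K + 1) * max 1 b := by
    rw [hS, Nat.cast_max, Nat.cast_one]
    have h1 : 1 ≤ max 1 b := le_max_left _ _
    have h2 : b ≤ max 1 b := le_max_right _ _
    have h3 := (Nat.ceil_lt_add_one (by positivity : 0 ≤ K * b)).le
    have h4 := mul_le_mul_of_nonneg_left h2 hK.le
    have h5 := mul_le_mul_of_nonneg_left h1 hK.le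
    exact max_le (by linarith) (by linarith)
  have hTS : (T : ℝ) * S ≤ 129 * X * ((K + 1) * max 1 b) :=
    mul_le_mul hT hS' (Nat.cast_nonneg _) (by positivity)
  have h0 : 0 ≤ (T : ℝ) * S := by positivity
  simp only [sgdaCost, segCost, Nat.cast_mul, Nat.cast_ofNat]
  constructor <;> linarith

end Complexity

end Minimax

/-! ### Choice of constants and conclusion -/

theorem theorem4 :
    ∃ (KT : ℝ) (KS KG : ℝ → ℝ), 0 < KT ∧ (∀ p, 0 < KS p ∧ 0 < KG p) ∧
    ∀ (n m : ℕ), 0 < n → 0 < m →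
    ∀ (f : Pt n m → ℝ) (U : Set (Pt n m)) (zs : Pt n m) (L : ℝ),
      IsOpen U → zs ∈ U → ContDiffOn ℝ 2 f U → IsDiffStackelberg f zs →
      specNorm (blockA f zs) ≤ L → specNorm (blockB f zs) ≤ L → specNorm (blockC f zs) ≤ L →
    ∀ (r : ℝ), 2 * kappa f zs L ≤ r →
    ∀ (Q : Matrix (Fin n ⊕ Fin m) (Fin n ⊕ Fin m) ℂ) (ev : Fin n ⊕ Fin m → ℂ),
      IsEigDecomp (matM f zs r) Q ev →
    ∃ δ : ℝ, 0 < δ ∧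
    ∀ z₀ : Pt n m, ‖z₀ - zs‖ ≤ δ →
    ∀ p : ℝ, 0 < p → p < 1 →
    ∀ σ : ℝ, 0 ≤ σ →
    ∀ ε : ℝ, 0 < ε → ε ≤ condNum Q * ‖z₀ - zs‖ →
    ∀ ℓ : ℝ, ℓ = logFactor (condNum Q) ‖z₀ - zs‖ ε →
    ∀ b : ℝ, b = batchFactor r (kappaX f zs L) (condNum Q) σ L ε ℓ →
    ∀ T : ℕ, T = ⌈KT * (r * kappaX f zs L * ℓ)⌉₊ →
      -- convergence with the above `T` and every batch size `S ≥ KS(p) * b`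
      (∀ S : ℕ, 1 ≤ S → KS p * b ≤ S →
        ∀ {Ω : Type*} [MeasurableSpace Ω] (P : Measure Ω) [IsProbabilityMeasure P]
          (g : ℕ → Ω → Pt n m → Pt n m),
          (IsMiniBatchNoise P σ S (noise f g (sgda g (1 / (4 * r * L)) (1 / (4 * L)) z₀)) →
            1 - p ≤ P.real {ω | ‖sgda g (1 / (4 * r * L)) (1 / (4 * L)) z₀ T ω - zs‖ ≤ ε}) ∧
          (IsMiniBatchNoise P σ S (noise f g (segQuery g (1 / (4 * r * L)) (1 / (4 * L)) z₀)) →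
            1 - p ≤ P.real {ω | ‖seg g (1 / (4 * r * L)) (1 / (4 * L)) z₀ T ω - zs‖ ≤ ε})) ∧
      -- total number of gradient evaluations for the smallest such batch size
      (∀ S : ℕ, S = max 1 ⌈KS p * b⌉₊ →
        (sgdaCost T S : ℝ) ≤ KG p * (r * kappaX f zs L * ℓ * max 1 b) ∧
        (segCost T S : ℝ) ≤ KG p * (r * kappaX f zs L * ℓ * max 1 b))
    := by
  have hKS (p : ℝ) : 0 < if 0 < p then 532512 / p else 1 := by
    split_ifs with h <;> positivity
  -- Here 532512 = 32 · 129², where T ≤ 129 X absorbs the ceiling since X = r κ_x ℓ ≥ 1, and 258 = 2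
  -- · 129. The value 1 for p ≤ 0 only ensures positivity.
  refine ⟨128, fun p => if 0 < p then 532512 / p else 1,
    fun p => 258 * ((if 0 < p then 532512 / p else 1) + 1), by norm_num,
    fun p => ⟨hKS p, by linarith [hKS p]⟩, ?_⟩
  intro n m hn hm f U zs L hU hzU hf hz hA hB hC r hr Q ev hQ
  have hS := hz.stackelbergBlocks hn hm hA hB hC hr
  obtain ⟨δ', hδ', H⟩ := exists_locallyContracting hU hzU hf hz hS hQ
  have hL := hS.L_pos
  have hr2 := hS.two_le
  have hκx : 1 ≤ kappaX f zs L := by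
    rw [kappaX, le_div_iff₀ hS.mux_pos, one_mul]
    exact hS.mux_le
  set κx := kappaX f zs L with hκxdef
  set CP := condNum Q with hCP
  have hCP1 : 1 ≤ CP := by
    refine one_le_condNum hQ.1 (e := EuclideanSpace.single (Sum.inl ⟨0, hn⟩) 1) ?_
    intro h0
    have := congrArg norm h0
    simp at this
  have hCPpos : 0 < CP := by linarith
  have hQ0 := specNorm_nonneg Q
  have hQi0 := specNorm_nonneg Q⁻¹
  have hprod : specNorm Q⁻¹ * specNorm Q = CP := by rw [hCP, condNum, mul_comm]
  -- The bootstrap runs with R = 2‖Q‖d, where d = ‖z₀ - zs‖: half for the initial error, half for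
  -- the noise. The required radius ‖Q⁻¹‖ · 2R is then 4 C_P d.
  refine ⟨δ' / (4 * CP), by positivity, ?_⟩
  intro z₀ hz₀ p hp hp1 σ hσ ε hε hεd ℓ hℓ b hb T hT
  set d := ‖z₀ - zs‖ with hd
  have hdpos : 0 < CP * d := hε.trans_le hεd
  have hd0 : 0 ≤ d := norm_nonneg _
  have hℓ1 : 1 ≤ ℓ := by rw [hℓ]; exact le_max_left _ _
  have hℓlog : Real.log (CP * d / ε) ≤ ℓ := by rw [hℓ]; exact le_max_right _ _
  have hrκ : 1 ≤ r * κx := by nlinarith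
  have hX : 1 ≤ r * κx * ℓ := by nlinarith
  set X := r * κx * ℓ with hXdef
  have hTlow : 128 * X ≤ T := by rw [hT]; exact Nat.le_ceil _
  have hTup : (T : ℝ) ≤ 129 * X := by
    have := (Nat.ceil_lt_add_one (by positivity : 0 ≤ 128 * X)).le
    rw [← hT] at this
    linarith
  have hb' : b = X ^ 2 * CP ^ 2 * σ ^ 2 / (L ^ 2 * ε ^ 2) := by
    rw [hb, batchFactor, hXdef]; ring
  have hb0 : 0 ≤ b := by rw [hb']; positivity
  refine ⟨fun S hS1 hSb Ω _ P _ g => ?_, fun S hS => cost_le hX hb0 (hKS p) hTup hS⟩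
  simp only [if_pos hp] at hSb
  have hSpos : (0 : ℝ) < S := by exact_mod_cast hS1
  -- Total noise at most a adds at most ε/4 to the final error; the geometric term adds at most ε/2.
  set a : ℝ := L * ε / (2 * CP) with ha
  have hapos : 0 < a := by positivity
  have hfail : ((2 * T : ℕ) : ℝ) ^ 2 * (2 * σ ^ 2 / S) / a ^ 2 ≤ p := by
    have e : ((2 * T : ℕ) : ℝ) ^ 2 * (2 * σ ^ 2 / S) / a ^ 2
        = (T : ℝ) ^ 2 * (32 * CP ^ 2 * σ ^ 2 / (L ^ 2 * ε ^ 2)) / S := by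
      rw [ha]; push_cast; field_simp; ring
    rw [e, div_le_iff₀ hSpos]
    have h1 : (T : ℝ) ^ 2 ≤ (129 * X) ^ 2 := pow_le_pow_left₀ (Nat.cast_nonneg _) hTup 2
    calc _ ≤ (129 * X) ^ 2 * (32 * CP ^ 2 * σ ^ 2 / (L ^ 2 * ε ^ 2)) :=
          mul_le_mul_of_nonneg_right h1 (by positivity)
      _ = p * (532512 / p * b) := by rw [hb']; field_simp; ring
      _ ≤ p * S := mul_le_mul_of_nonneg_left hSb hp.le
  have hnoise {s : ℝ} (hs : s ≤ a) :
      2 * (specNorm Q * (1 / (4 * L))) * s ≤ specNorm Q * (ε / (4 * CP)) := by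
    have e : 2 * (specNorm Q * (1 / (4 * L))) * a = specNorm Q * (ε / (4 * CP)) := by
      rw [ha]; field_simp
    rw [← e]
    exact mul_le_mul_of_nonneg_left hs (by positivity)
  have hεd' : ε / (4 * CP) ≤ d := by
    rw [div_le_iff₀ (by positivity)]
    linarith
  have hN0 : eigNorm Q (z₀ - zs) ≤ specNorm Q * d := eigNorm_le _
  have hRδ : specNorm Q⁻¹ * (2 * (2 * (specNorm Q * d))) ≤ δ' := by
    have e : specNorm Q⁻¹ * (2 * (2 * (specNorm Q * d))) = d * (4 * CP) := by rw [← hprod]; ring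
    rw [e, ← le_div_iff₀ (by positivity)]
    exact hz₀
  have hR {s : ℝ} (hs : s ≤ a) : eigNorm Q (z₀ - zs) + 2 * (specNorm Q * (1 / (4 * L))) * s
      ≤ 2 * (specNorm Q * d) := by
    have := (hnoise hs).trans (mul_le_mul_of_nonneg_left hεd' hQ0)
    linarith
  have hτ0 : 0 < 1 / (r * κx) := by positivity
  have hfinal {z : Pt n m} {s : ℝ} (hs : s ≤ a)
      (hzN : eigNorm Q (z - zs) ≤ (1 - 1 / (r * κx) / 64) ^ T * eigNorm Q (z₀ - zs)
        + 2 * (specNorm Q * (1 / (4 * L))) * s) : ‖z - zs‖ ≤ ε := by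
    have hτ1 := H.tau_le_one
    have hgeo := geometric_mul_le (T := T) hτ0 hτ1 hε hdpos hℓ1 hℓlog (by
      have e : 128 * ℓ / (1 / (r * κx)) = 128 * X := by rw [hXdef]; field_simp
      rw [e]; exact hTlow)
    have hρ : 0 ≤ (1 - 1 / (r * κx) / 64) ^ T := pow_nonneg (by linarith) T
    have h1 := hzN.trans (add_le_add (mul_le_mul_of_nonneg_left hN0 hρ) (hnoise hs))
    have h2 := (norm_le_eigNorm hQ.1 (z - zs)).trans (mul_le_mul_of_nonneg_left h1 hQi0)
    have e : specNorm Q⁻¹ * ((1 - 1 / (r * κx) / 64) ^ T * (specNorm Q * d)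
        + specNorm Q * (ε / (4 * CP))) = (1 - 1 / (r * κx) / 64) ^ T * (CP * d) + ε / 4 := by
      have e' : CP * (ε / (4 * CP)) = ε / 4 := by field_simp
      rw [← e', ← hprod]; ring
    rw [e] at h2
    linarith
  constructor
  · intro hN
    have hprob := hN.one_sub_le_measureReal_sum_le (2 * T) hapos
    refine (by linarith : 1 - p ≤ _).trans (hprob.trans (measureReal_mono fun ω hω => ?_))
    exact hfinal hω (H.gradient_iterates_le (z := fun k => sgda g _ _ z₀ k ω)
      (ξ := fun k => noise f g (sgda g _ _ z₀) k ω) (fun k => sgda_succ k ω) hRδ (hR hω))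
  · intro hN
    have hprob := hN.one_sub_le_measureReal_sum_le (2 * T) hapos
    refine (by linarith : 1 - p ≤ _).trans (hprob.trans (measureReal_mono fun ω hω => ?_))
    exact hfinal hω (H.extragradient_iterates_le (z := fun k => seg g _ _ z₀ k ω)
      (z' := fun k => segQuery g _ _ z₀ (2 * k + 1) ω)
      (ξ := fun k => noise f g (segQuery g _ _ z₀) k ω) (fun k => segQuery_odd k ω)
      (fun k => seg_succ k ω) hRδ (hR hω))
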